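/- **Setting.** Let $\mathfrak g=\mathfrak k\oplus\mathfrak p$ be a finite-dimensional real vector space with an inner product $\langle\cdot,\cdot\rangle$ on $\mathfrak p$. Let $\mu_0$ be a Lie bracket on $\mathfrak g$ with $\mu_0(\mathfrak k,\mathfrak k)\subset\mathfrak k$, $\mu_0(\mathfrak k,\mathfrak p)\subset\mathfrak p$, with $\mathrm{ad}_{\mu_0}Z|_{\mathfrak p}$ skew-symmetric for all $Z\in\mathfrak k$, and with $\{Z\in\mathfrak k:\mu_0(Z,\mathfrak p)=0\}=0$. If the connected subgroup $K$ with Lie algebra $\mathfrak k$ is closed in the simply connected Lie group $G$ with Lie algebra $(\mathfrak g,\mu_0)$, then $\mu_0$ is a simply connected homogeneous space $(G/K,g_{\mu_0})$ with $T_o(G/K)=\mathfrak p$ and $g_{\mu_0}(o)=\langle\cdot,\cdot\rangle$; closedness is not needed below. For an inner product $g$ on $\mathfrak p$, $\mathrm{ric}(g)$ denotes the Ricci tensor at the origin of the corresponding invariant metric, i.e. $\mathrm{ric}(g)(X,Y)=\mathrm{tr}\,(Z\mapsto R(Z,X)Y)$ with $R(X,Y)=[\Lambda_X,\Lambda_Y]-\Lambda_{\mu(X,Y)_{\mathfrak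 p}}-\mathrm{ad}_\mu(\mu(X,Y)_{\mathfrak k})|_{\mathfrak p}$, where $\Lambda:\mathfrak p\to\mathfrak{gl}(\mathfrak p)$ is the unique linear map with $\Lambda_XY-\Lambda_YX=\mu(X,Y)_{\mathfrak p}$ and all $\Lambda_X$ skew with respect to $g$. $\mathrm{Ric}_\mu$ is the operator given by $\langle \mathrm{Ric}_\mu X,Y\rangle=\mathrm{ric}(\langle\cdot,\cdot\rangle)(X,Y)$. The (unnormalized) bracket flow is the ODE for alternating brackets $$\nu'=-\pi\left(\begin{smallmatrix}0&0\\0&\mathrm{Ric}_\nu\end{smallmatrix}\right)\nu,\qquad \nu(0)=\mu_0,\qquad \pi(T)\mu=T\mu(\cdot,\cdot)-\mu(T\cdot,\cdot)-\mu(\cdot,T\cdot),$$ considered on open intervals containing $0$. $\mathrm{GL}(\mathfrak g)$ acts on brackets by $h\cdot\mu=h\mu(h^{-1}\cdot,h^{-1}\cdot)$, and for $r\neq0$ the rescaling $r\cdot\mu$ is the action of $\left(\begin{smallmatrix}I&0\\0&r^{-1}I\end{smallmatrix}\right)$. For $T\in\mathrm{End}(\mathfrak g)$, $T_{\mathfrak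 p}$ is the restriction to $\mathfrak p$ followed by projection to $\mathfrak p$. $\mu_0$ is a *semi-algebraic soliton* if there are, for $t$ in an open interval around $0$, numbers $a(t)>0$ and automorphisms $\varphi_t$ of $(\mathfrak g,\mu_0)$ with $\varphi_t(\mathfrak k)=\mathfrak k$ such that $g_t=a(t)\langle(\varphi_t)_{\mathfrak p}\cdot,(\varphi_t)_{\mathfrak p}\cdot\rangle$ satisfies $g_0=\langle\cdot,\cdot\rangle$ and the Ricci flow equation $\frac{d}{dt}g_t=-2\,\mathrm{ric}(g_t)$. Let $c\in\mathbb R$, let $I_c=\{t:-2ct+1>0\}$ (that is, $(\frac1{2c},\infty)$ if $c<0$, $(-\infty,\frac1{2c})$ if $c>0$, $\mathbb R$ if $c=0$), and let $s(t)=-\frac1{2c}\ln(-2ct+1)$ for $c\ne0$, $s(t)=t$ for $c=0$. For $D\in\mathrm{End}(\mathfrak g)$ put $A=\frac12(D_{\mathfrak p}-D_{\mathfrak p}^t)$ and $$\nu_{c,D}(t)=(-2ct+1)^{-1/2}\cdot\left(\left(\begin{smallmatrix}I&0\\0&e^{s(t)A}e^{-s(t)D_{\mathfrak p}}\end{smallmatrix}\right)\cdot\mu_0\right),\qquad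 t\in I_c.$$ **Proposition.** 1. Suppose $D=\left(\begin{smallmatrix}0&*\\0&D_{\mathfrak p}\end{smallmatrix}\right)$ is a derivation of $(\mathfrak g,\mu_0)$ and $\mathrm{Ric}_{\mu_0}=cI+\frac12(D_{\mathfrak p}+D_{\mathfrak p}^t)$. Then $\nu_{c,D}$ is a solution of the bracket flow on $I_c$ starting at $\mu_0$, and every solution starting at $\mu_0$ on an open interval $J\ni0$ agrees with it on $J\cap I_c$. 2. Conversely, suppose $D=\left(\begin{smallmatrix}0&*\\0&D_{\mathfrak p}\end{smallmatrix}\right)$ is a derivation of $(\mathfrak g,\mu_0)$ and a bracket flow solution starting at $\mu_0$ on an open interval $J\ni 0$ agrees with $\nu_{c,D}$ on $J\cap I_c$. Then $\mu_0$ is a semi-algebraic soliton, and there is a derivation $\tilde D=\left(\begin{smallmatrix}0&*\\0&\tilde D_{\mathfrak p}\end{smallmatrix}\right)$ of $(\mathfrak g,\mu_0)$ with $\mathrm{Ric}_{\mu_0}=cI+\frac12(\tilde D_{\mathfrak p}+\tilde D_{\mathfrak p}^t)$ and $\frac12(\tilde D_{\mathfrak p}-\tilde D_{\mathfrak p}^t)=A$.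 3. In part 2 it can happen that $\tilde D_{\mathfrak p}\neq D_{\mathfrak p}$: there are $\mu_0,c,D$ as in part 2, with $\nu_{c,D}$ a bracket flow solution on $I_c$, such that no $\tilde D$ as in part 2 has $\tilde D_{\mathfrak p}=D_{\mathfrak p}$. -/

import Mathlib

open scoped RealInnerProductSpace

namespace BracketFlow

noncomputable section

variable {k p : Type*} [NormedAddCommGroup k] [NormedSpace ℝ k]
  [NormedAddCommGroup p] [InnerProductSpace ℝ p]

/-- Bilinear maps `𝔤 × 𝔤 → 𝔤` on the fixed vector space `𝔤 = 𝔨 ⊕ 𝔭` (realised as `k × p`).  The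
space `V_{q+n}` consists of the alternating ones.  The space `p` carries the fixed inner product;
the norm of `k` serves only to provide the topology of a finite-dimensional space. -/
abbrev BracketSpace (k p : Type*) [NormedAddCommGroup k] [NormedSpace ℝ k]
    [NormedAddCommGroup p] [InnerProductSpace ℝ p] : Type _ :=
  (k × p) →ₗ[ℝ] (k × p) →ₗ[ℝ] (k × p)

/-- The `𝔭`-component `μ_𝔭(X, Y)` of the bracket of `X, Y ∈ 𝔭`, as a bilinear map. -/
def pBracket (μ : BracketSpace k p) : p →ₗ[ℝ] p →ₗ[ℝ] p :=
  (μ.compl₁₂ (LinearMap.inr ℝ k p) (LinearMap.inr ℝ k p)).compr₂ (LinearMap.snd ℝ k p)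

/-- The `𝔨`-component `μ_𝔨(X, Y)` of the bracket of `X, Y ∈ 𝔭`, as a bilinear map. -/
def kBracket (μ : BracketSpace k p) : p →ₗ[ℝ] p →ₗ[ℝ] k :=
  (μ.compl₁₂ (LinearMap.inr ℝ k p) (LinearMap.inr ℝ k p)).compr₂ (LinearMap.fst ℝ k p)

/-- The isotropy representation `Z ↦ ad_μ Z|_𝔭`, for `Z ∈ 𝔨`. -/
def isotropy (μ : BracketSpace k p) : k →ₗ[ℝ] p →ₗ[ℝ] p :=
  (μ.compl₁₂ (LinearMap.inl ℝ k p) (LinearMap.inr ℝ k p)).compr₂ (LinearMap.snd ℝ k p)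

/-- `μ` is the Lie bracket of an (almost effective) homogeneous Riemannian space with reductive
decomposition `𝔤 = 𝔨 ⊕ 𝔭` and metric at the origin equal to the inner product of `p`.  The
connected subgroup with Lie algebra `𝔨` is not required to be closed in the simply connected group
of `(𝔤, μ)`: brackets for which it is not closed (locally homogeneous spaces) are included. -/
structure IsHomogeneous (μ : BracketSpace k p) : Prop where
  alt : ∀ x, μ x x = 0
  jacobi : ∀ x y z, μ x (μ y z) + μ y (μ z x) + μ z (μ x y) = 0
  k_subalgebra : ∀ Z W : k, (μ (Z, 0) (W, 0)).2 = 0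
  reductive : ∀ (Z : k) (X : p), (μ (Z, 0) (0, X)).1 = 0
  skew : ∀ (Z : k) (X Y : p), ⟪isotropy μ Z X, Y⟫ = -⟪X, isotropy μ Z Y⟫
  almost_effective : ∀ Z : k, (∀ X : p, μ (Z, 0) (0, X) = 0) → Z = 0

/-! ### Curvature of invariant metrics

A metric invariant under the group of `(𝔤, μ)` is given by an inner product `g` on `𝔭`; an invariant
affine connection is given by a bilinear map `Λ : 𝔭 → gl(𝔭)`. -/

/-- `Λ` is the Levi-Civita connection of the invariant metric `g`: it is torsion free
and metric. -/
structure IsLeviCivita (μ : BracketSpace k p) (g : p →ₗ[ℝ] p →ₗ[ℝ] ℝ)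
    (Λ : p →ₗ[ℝ] p →ₗ[ℝ] p) : Prop where
  torsion_free : ∀ X Y, Λ X Y - Λ Y X = pBracket μ X Y
  metric : ∀ X Y Z, g (Λ X Y) Z + g Y (Λ X Z) = 0

/-- The fundamental lemma: existence and uniqueness of the Levi-Civita connection. -/
theorem existsUnique_isLeviCivita [FiniteDimensional ℝ p] (μ : BracketSpace k p)
    (hμ : ∀ x, μ x x = 0) (g : p →ₗ[ℝ] p →ₗ[ℝ] ℝ) (hsymm : ∀ X Y, g X Y = g Y X)
    (hpos : ∀ X, X ≠ 0 → 0 < g X X) : ∃! Λ, IsLeviCivita μ g Λ := by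
  have hskew : ∀ X Y, pBracket μ X Y = -pBracket μ Y X := by
    intro X Y
    have h := hμ ((0, X) + (0, Y))
    simp only [map_add, LinearMap.add_apply, hμ, zero_add, add_zero] at h
    simp only [pBracket, LinearMap.compr₂_apply, LinearMap.compl₁₂_apply, LinearMap.inr_apply,
      LinearMap.snd_apply]
    exact eq_neg_of_add_eq_zero_right (by simpa using congrArg Prod.snd h)
  have hinj : Function.Injective g := by
    rw [injective_iff_map_eq_zero]
    intro X hX
    by_contra hne
    exact (hpos X hne).ne' (by rw [hX]; rfl)
  have hext : ∀ V W : p, (∀ Z, g V Z = g W Z) → V = W := fun V W h => hinj (LinearMap.ext h)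
  let e : p ≃ₗ[ℝ] (p →ₗ[ℝ] ℝ) := LinearEquiv.ofBijective g
    ⟨hinj, (LinearMap.injective_iff_surjective_of_finrank_eq_finrank
      (Subspace.dual_finrank_eq (K := ℝ) (V := p)).symm).1 hinj⟩
  have he : ∀ f Z, g (e.symm f) Z = f Z := fun f Z => LinearMap.congr_fun (e.apply_symm_apply f) Z
  let b := pBracket μ
  let kos : p →ₗ[ℝ] p →ₗ[ℝ] p →ₗ[ℝ] ℝ :=
    LinearMap.mk₂ ℝ (fun X Y => (1 / 2 : ℝ) • (g (b X Y) + g Y ∘ₗ b.flip X + g X ∘ₗ b.flip Y))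
      (by intros; ext; simp; ring) (by intros; ext; simp; ring)
      (by intros; ext; simp; ring) (by intros; ext; simp; ring)
  have hkos : ∀ X Y Z, kos X Y Z = (1 / 2 : ℝ) * (g (b X Y) Z + g Y (b Z X) + g X (b Z Y)) := by
    intro X Y Z
    simp [kos]
    ring
  refine ⟨kos.compr₂ e.symm.toLinearMap, ⟨?_, ?_⟩, ?_⟩
  · intro X Y
    apply hext
    intro Z
    simp only [LinearMap.compr₂_apply, LinearEquiv.coe_coe, map_sub, LinearMap.sub_apply, he, hkos]
    have : b Y X = -b X Y := hskew Y X
    change _ = g (b X Y) Z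
    rw [this]
    simp only [map_neg, LinearMap.neg_apply]
    ring
  · intro X Y Z
    simp only [LinearMap.compr₂_apply, LinearEquiv.coe_coe]
    rw [hsymm Y, he, he, hkos, hkos, hsymm (b X Y) Z, hsymm (b X Z) Y]
    have h1 : b Z X = -b X Z := hskew Z X
    have h2 : b Y X = -b X Y := hskew Y X
    have h3 : b Z Y = -b Y Z := hskew Z Y
    rw [h1, h2, h3]
    simp only [map_neg]
    ring
  · intro Λ hΛ
    ext X Y
    apply hext
    intro Z
    simp only [LinearMap.compr₂_apply, LinearEquiv.coe_coe, he, hkos]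
    have t1 : b X Y = Λ X Y - Λ Y X := (hΛ.torsion_free X Y).symm
    have t2 : b Z X = Λ Z X - Λ X Z := (hΛ.torsion_free Z X).symm
    have t3 : b Z Y = Λ Z Y - Λ Y Z := (hΛ.torsion_free Z Y).symm
    have m1 := hΛ.metric X Y Z
    have m2 := hΛ.metric Y X Z
    have m3 := hΛ.metric Z X Y
    rw [t1, t2, t3]
    simp only [map_sub, LinearMap.sub_apply]
    rw [hsymm (Λ Z X) Y] at m3
    linarith

open Classical in
/-- The Levi-Civita connection of the invariant metric `g`. -/
def leviCivita (μ : BracketSpace k p) (g : p →ₗ[ℝ] p →ₗ[ℝ] ℝ) : p →ₗ[ℝ] p →ₗ[ℝ] p :=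
  if h : ∃ Λ, IsLeviCivita μ g Λ then h.choose else 0

theorem isLeviCivita_leviCivita (μ : BracketSpace k p) (g : p →ₗ[ℝ] p →ₗ[ℝ] ℝ)
    (h : ∃ Λ, IsLeviCivita μ g Λ) : IsLeviCivita μ g (leviCivita μ g) := by
  rw [leviCivita, dif_pos h]
  exact h.choose_spec

/-- The curvature `R(X, Y) = [Λ(X), Λ(Y)] - Λ([X, Y]_𝔭) - ad([X, Y]_𝔨)|_𝔭` at the origin of the
invariant connection `Λ`. -/
def curvature (μ : BracketSpace k p) (Λ : p →ₗ[ℝ] p →ₗ[ℝ] p) (X Y : p) : p →ₗ[ℝ] p :=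
  Λ X ∘ₗ Λ Y - Λ Y ∘ₗ Λ X - Λ (pBracket μ X Y) - isotropy μ (kBracket μ X Y)

/-- The Ricci tensor at the origin of the invariant metric `g`:
`ric(X, Y)` is the trace of `Z ↦ R(Z, X) Y`. -/
def ricciTensor (μ : BracketSpace k p) (g : p →ₗ[ℝ] p →ₗ[ℝ] ℝ) : p →ₗ[ℝ] p →ₗ[ℝ] ℝ :=
  LinearMap.mk₂ ℝ
    (fun X Y => LinearMap.trace ℝ p
      { toFun := fun Z => curvature μ (leviCivita μ g) Z X Y
        map_add' := by intros; simp [curvature]; abel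
        map_smul' := by intros; simp [curvature, smul_sub] })
    (by intros; rw [← map_add]; congr 1; ext; simp [curvature]; abel)
    (by intros; rw [← map_smul]; congr 1; ext; simp [curvature, smul_sub])
    (by intros; rw [← map_add]; congr 1; ext; simp [curvature]; abel)
    (by intros; rw [← map_smul]; congr 1; ext; simp [curvature, smul_sub])

/-- The Ricci operator `Ric_μ` of the metric given by the fixed inner product of `p`. -/
def ricciOperator [FiniteDimensional ℝ p] (μ : BracketSpace k p) : p →ₗ[ℝ] p :=
  ∑ i, ((ricciTensor μ (innerₗ p)).flip (stdOrthonormalBasis ℝ p i)).smulRight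
    (stdOrthonormalBasis ℝ p i)

theorem inner_ricciOperator [FiniteDimensional ℝ p] (μ : BracketSpace k p) (X Y : p) :
    ⟪ricciOperator μ X, Y⟫ = ricciTensor μ (innerₗ p) X Y := by
  conv_rhs => rw [← (stdOrthonormalBasis ℝ p).sum_repr' Y]
  simp only [ricciOperator, LinearMap.sum_apply, LinearMap.smulRight_apply, LinearMap.flip_apply,
    sum_inner, real_inner_smul_left, map_sum, map_smul, smul_eq_mul]
  exact Finset.sum_congr rfl fun i _ => mul_comm _ _

/-! ### The bracket flow -/

/-- The block-diagonal endomorphism of `𝔤 = 𝔨 ⊕ 𝔭` with blocks `S` and `T`. -/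
abbrev diag (S : k →ₗ[ℝ] k) (T : p →ₗ[ℝ] p) : (k × p) →ₗ[ℝ] (k × p) :=
  S.prodMap T

/-- The representation `(π(T)μ)(x, y) = T μ(x, y) - μ(T x, y) - μ(x, T y)` of `gl(𝔤)`. -/
def rep (T : (k × p) →ₗ[ℝ] (k × p)) (μ : BracketSpace k p) (x y : k × p) : k × p :=
  T (μ x y) - μ (T x) y - μ x (T y)

/-- The action `(h·μ)(x, y) = h μ(h⁻¹ x, h⁻¹ y)` of `GL(𝔤)`; it is used for invertible `h` only. -/
def act (h : (k × p) →ₗ[ℝ] (k × p)) (μ : BracketSpace k p) : BracketSpace k p :=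
  (μ.compl₁₂ (Ring.inverse (M₀ := Module.End ℝ (k × p)) h)
    (Ring.inverse (M₀ := Module.End ℝ (k × p)) h)).compr₂ h

/-- The rescaling `r·μ` for `r ≠ 0`, that is, the action of `diag(I, r⁻¹ I)`.  If `μ` is reductive
this leaves `μ` unchanged on `𝔨 × 𝔤` and gives `r² μ_𝔨 + r μ_𝔭` on `𝔭 × 𝔭`. -/
def rescale (r : ℝ) (μ : BracketSpace k p) : BracketSpace k p :=
  act (diag LinearMap.id (r⁻¹ • LinearMap.id)) μ

/-- `ν` is a solution on the open interval `J ∋ 0` of the (unnormalized) bracket flow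
`ν' = -π(diag(0, Ric_ν)) ν`, `ν(0) = μ₀`, in the space of alternating bilinear maps. -/
structure IsBracketFlow [FiniteDimensional ℝ p] (μ₀ : BracketSpace k p) (J : Set ℝ)
    (ν : ℝ → BracketSpace k p) : Prop where
  isOpen : IsOpen J
  ordConnected : J.OrdConnected
  zero_mem : (0 : ℝ) ∈ J
  initial : ν 0 = μ₀
  alt : ∀ t ∈ J, ∀ x, ν t x x = 0
  hasDerivAt : ∀ t ∈ J, ∀ x y,
    HasDerivAt (fun τ => ν τ x y) (-rep (diag 0 (ricciOperator (ν t))) (ν t) x y) t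

/-! ### Semi-algebraic solitons -/

/-- `T_𝔭`: restriction to `𝔭` followed by projection to `𝔭`. -/
def pPart (T : (k × p) →ₗ[ℝ] (k × p)) : p →ₗ[ℝ] p :=
  LinearMap.snd ℝ k p ∘ₗ T ∘ₗ LinearMap.inr ℝ k p

/-- `D` is a derivation of `(𝔤, μ)` with `D 𝔨 = 0`, i.e. of the block form `[0 *; 0 D_𝔭]`. -/
structure IsDerivationKilling (μ : BracketSpace k p) (D : (k × p) →ₗ[ℝ] (k × p)) : Prop where
  leibniz : ∀ x y, D (μ x y) = μ (D x) y + μ x (D y)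
  apply_k : ∀ Z : k, D (Z, 0) = 0

/-- The symmetric part `½(T + Tᵗ)`. -/
def symPart [FiniteDimensional ℝ p] (T : p →ₗ[ℝ] p) : p →ₗ[ℝ] p :=
  (1 / 2 : ℝ) • (T + LinearMap.adjoint T)

/-- The skew-symmetric part `½(T - Tᵗ)`. -/
def skewPart [FiniteDimensional ℝ p] (T : p →ₗ[ℝ] p) : p →ₗ[ℝ] p :=
  (1 / 2 : ℝ) • (T - LinearMap.adjoint T)

/-- The (unnormalized) Ricci flow `g' = -2 ric(g)` for a curve of invariant metrics, given by their
values `g t` at the origin. -/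
def IsRicciFlow (μ : BracketSpace k p) (J : Set ℝ) (g : ℝ → p →ₗ[ℝ] p →ₗ[ℝ] ℝ) : Prop :=
  ∀ t ∈ J, ∀ X Y, HasDerivAt (fun τ => g τ X Y) (-2 * ricciTensor μ (g t) X Y) t

/-- `φ` is an automorphism of `(𝔤, μ)` with `φ(𝔨) = 𝔨`; for a simply connected group and a connected
isotropy subgroup `K`, these are the differentials of the automorphisms of the group that
map `K` onto `K`. -/
structure IsIsotropyAut (μ : BracketSpace k p) (φ : (k × p) ≃ₗ[ℝ] (k × p)) : Prop where
  map_bracket : ∀ x y, φ (μ x y) = μ (φ x) (φ y)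
  map_k : (LinearMap.range (LinearMap.inl ℝ k p)).map φ.toLinearMap =
    LinearMap.range (LinearMap.inl ℝ k p)

/-- The value at the origin of the pullback of the given metric by the equivariant diffeomorphism
with differential `φ`. -/
def pullback (φ : (k × p) ≃ₗ[ℝ] (k × p)) : p →ₗ[ℝ] p →ₗ[ℝ] ℝ :=
  (innerₗ p).compl₁₂ (pPart φ.toLinearMap) (pPart φ.toLinearMap)

/-- There are automorphisms `φ_t` with `φ_t(𝔨) = 𝔨` and `c(t) > 0` such that `g(t) = c(t) φ_t^* g`
solves the Ricci flow with `g(0) = g`, the given metric. -/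
def IsSemiAlgebraicSoliton (μ : BracketSpace k p) : Prop :=
  ∃ ε > 0, ∃ (c : ℝ → ℝ) (φ : ℝ → (k × p) ≃ₗ[ℝ] (k × p)),
    (∀ t ∈ Set.Ioo (-ε) ε, 0 < c t ∧ IsIsotropyAut μ (φ t)) ∧
    c 0 • pullback (φ 0) = innerₗ p ∧
    IsRicciFlow μ (Set.Ioo (-ε) ε) (fun t => c t • pullback (φ t))

/-- `Ric_μ = c I + ½(D_𝔭 + D_𝔭ᵗ)` with `D = [0 *; 0 D_𝔭]` a derivation. -/
structure SolitonEquation [FiniteDimensional ℝ p] (μ : BracketSpace k p) (c : ℝ)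
    (D : (k × p) →ₗ[ℝ] (k × p)) : Prop where
  derivation : IsDerivationKilling μ D
  ricci_eq : ricciOperator μ = c • LinearMap.id + symPart (pPart D)

/-- The exponential of an endomorphism of `p`. -/
def expEnd [FiniteDimensional ℝ p] (T : p →ₗ[ℝ] p) : p →ₗ[ℝ] p :=
  (NormedSpace.exp (LinearMap.toContinuousLinearMap T) : p →L[ℝ] p)

/-- The time interval: `(1/(2c), ∞)` for `c < 0`, `(-∞, 1/(2c))` for `c > 0`, all of `ℝ`
for `c = 0`. -/
def timeInterval (c : ℝ) : Set ℝ :=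
  {t | 0 < -2 * c * t + 1}

/-- `s(t) = -(1/(2c)) ln(-2ct + 1)`, and `s(t) = t` for `c = 0`. -/
def sTime (c t : ℝ) : ℝ :=
  if c = 0 then t else -(1 / (2 * c)) * Real.log (-2 * c * t + 1)

/-- The curve `(-2ct+1)^{-1/2} · (diag(I, e^{s(t)A} e^{-s(t)D_𝔭}) · μ₀)`, `A = ½(D_𝔭 - D_𝔭ᵗ)`. -/
def solitonCurve [FiniteDimensional ℝ p] (μ₀ : BracketSpace k p) (c : ℝ)
    (D : (k × p) →ₗ[ℝ] (k × p)) (t : ℝ) : BracketSpace k p :=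
  rescale ((-2 * c * t + 1) ^ (-(1 / 2) : ℝ))
    (act (diag LinearMap.id
      (expEnd (sTime c t • skewPart (pPart D)) ∘ₗ expEnd (-(sTime c t) • pPart D))) μ₀)

end

end BracketFlow

/-!
A derivation `D` that kills `𝔨` need not preserve the complement `𝔭`, so `e^{-s D_𝔭}` on `𝔭` is in
general not induced by an automorphism preserving `𝔤 = 𝔨 ⊕ 𝔭`.  What makes the argument work is that
the Ricci tensor only sees `𝔤/𝔨`.  An invariant connection `Λ` on `𝔭`, extended to `𝔤` by the
isotropy representation (`extConn`), transforms naturally under every isomorphism of brackets that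
maps `𝔨` to `𝔨`, and its curvature `[Λ(x), Λ(y)] - Λ([x, y])` vanishes when `x ∈ 𝔨`
(`extCurv_isotropy_left`).  Hence the Ricci tensor is natural under all such isomorphisms
(`ricciTensor_pullback`).

The soliton curve is `ν(t) = diag(I, q(t))·μ₀` with `q(t) = (-2ct+1)^{1/2} e^{s(t)A} e^{-s(t)D_𝔭}`.
For any `D` its velocity is `π(diag(0, N))ν` with
`N = -(-2ct+1)⁻¹ e^{s(t)A} (cI + ½(D_𝔭 + D_𝔭ᵗ)) e^{-s(t)A}` (`hasDerivAt_solitonCurve`).  If `D` is a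
derivation, `diag(I, q(t)) e^{s(t)D}` is an isomorphism from `μ₀` to `ν(t)` which acts on `𝔤/𝔨` as a
homothety, so `Ric_{ν(t)} = (-2ct+1)⁻¹ e^{s(t)A} Ric_{μ₀} e^{-s(t)A}` (`ricciOperator_solitonCurve`).
The soliton equation says precisely that `N = -Ric_{ν(t)}`.  Uniqueness holds because the bracket
flow is an equation with polynomial right-hand side (`IsBracketFlow.eqOn`).

Conversely, if the soliton curve of a derivation `D` agrees with a solution, comparing the two
velocities at `t = 0` shows that `diag(0, Ric_{μ₀} - cI - ½(D_𝔭 + D_𝔭ᵗ))` is a derivation.  Its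
`𝔭`-part is symmetric, by the symmetry of the Ricci tensor, so adding it to `D` gives a solution of
the soliton equation with the same skew-symmetric part (`exists_solitonEquation`).  The scaled
pullbacks of the metric under `e^{-s(t)D}` then solve the Ricci flow, again by naturality
(`SolitonEquation.isSemiAlgebraicSoliton`).

The derivation may have to be changed: a symmetric block-diagonal derivation contributes nothing to
the soliton curve.  On the Heisenberg algebra, with its standard metric, the bracket flow merely
rescales the bracket, so `D = 0` gives the solution although the metric is not Einstein
(`exists_isBracketFlow_forall_pPart_ne`).
-/

namespace BracketFlow

section

variable {k p : Type*} [NormedAddCommGroup k] [NormedSpace ℝ k]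
  [NormedAddCommGroup p] [InnerProductSpace ℝ p]

/-! ### The connection as a map on the whole Lie algebra -/

theorem bracket_swap {μ : BracketSpace k p} (hμ : ∀ x, μ x x = 0) (x y : k × p) :
    μ x y = -μ y x := by
  have h := hμ (x + y)
  simp only [map_add, LinearMap.add_apply, hμ, zero_add, add_zero] at h
  exact eq_neg_of_add_eq_zero_right h

theorem isotropy_apply (μ : BracketSpace k p) (Z : k) (X : p) :
    isotropy μ Z X = (μ (Z, 0) (0, X)).2 := rfl

theorem pBracket_apply (μ : BracketSpace k p) (X Y : p) :
    pBracket μ X Y = (μ (0, X) (0, Y)).2 := rfl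

theorem kBracket_apply (μ : BracketSpace k p) (X Y : p) :
    kBracket μ X Y = (μ (0, X) (0, Y)).1 := rfl

/-- The extension of an invariant connection `Λ` to a linear map `𝔤 → gl(𝔭)`, equal to the isotropy
representation on `𝔨`.  Unlike `Λ`, it does not depend on the choice of the complement `𝔭`
of `𝔨`. -/
def extConn (μ : BracketSpace k p) (Λ : p →ₗ[ℝ] p →ₗ[ℝ] p) : (k × p) →ₗ[ℝ] p →ₗ[ℝ] p :=
  (isotropy μ).coprod Λ

theorem extConn_apply (μ : BracketSpace k p) (Λ : p →ₗ[ℝ] p →ₗ[ℝ] p) (x : k × p) :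
    extConn μ Λ x = isotropy μ x.1 + Λ x.2 := rfl

/-- The extended connection is torsion free on all of `𝔤`; this includes the definition of the
isotropy representation. -/
theorem extConn_torsion {μ : BracketSpace k p} (hμ : IsHomogeneous μ)
    {Λ : p →ₗ[ℝ] p →ₗ[ℝ] p} (hΛ : ∀ X Y, Λ X Y - Λ Y X = pBracket μ X Y) (x y : k × p) :
    extConn μ Λ x y.2 - extConn μ Λ y x.2 = (μ x y).2 := by
  obtain ⟨Z, X⟩ := x
  obtain ⟨W, Y⟩ := y
  have hx : ((Z, X) : k × p) = (Z, 0) + (0, X) := by simp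
  have hy : ((W, Y) : k × p) = (W, 0) + (0, Y) := by simp
  have h1 : (μ (0, X) (W, 0)).2 = -(μ (W, 0) (0, X)).2 := by
    rw [bracket_swap hμ.alt]; rfl
  rw [hx, hy]
  simp only [map_add, LinearMap.add_apply, Prod.snd_add, hμ.k_subalgebra, h1, extConn_apply,
    map_zero, zero_add, add_zero, isotropy_apply, ← pBracket_apply, ← hΛ]
  abel

/-- The curvature `[Λ(x), Λ(y)] - Λ([x, y])` of the extended connection, for `x, y ∈ 𝔤`. -/
def extCurv (μ : BracketSpace k p) (Λ : p →ₗ[ℝ] p →ₗ[ℝ] p) (x y : k × p) : p →ₗ[ℝ] p :=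
  extConn μ Λ x ∘ₗ extConn μ Λ y - extConn μ Λ y ∘ₗ extConn μ Λ x - extConn μ Λ (μ x y)

theorem extCurv_apply (μ : BracketSpace k p) (Λ : p →ₗ[ℝ] p →ₗ[ℝ] p) (x y : k × p) (V : p) :
    extCurv μ Λ x y V = extConn μ Λ x (extConn μ Λ y V) - extConn μ Λ y (extConn μ Λ x V)
      - extConn μ Λ (μ x y) V := rfl

theorem extCurv_swap {μ : BracketSpace k p} (hμ : ∀ x, μ x x = 0) (Λ : p →ₗ[ℝ] p →ₗ[ℝ] p)
    (x y : k × p) : extCurv μ Λ x y = -extCurv μ Λ y x := by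
  ext V
  rw [LinearMap.neg_apply, extCurv_apply, extCurv_apply, bracket_swap hμ x y]
  simp only [map_neg, LinearMap.neg_apply]
  abel

theorem curvature_eq_extCurv (μ : BracketSpace k p) (Λ : p →ₗ[ℝ] p →ₗ[ℝ] p) (X Y : p) :
    curvature μ Λ X Y = extCurv μ Λ (0, X) (0, Y) := by
  ext V
  simp only [curvature, extCurv_apply, extConn_apply, map_zero, zero_add, LinearMap.sub_apply,
    LinearMap.comp_apply, LinearMap.add_apply, pBracket_apply, kBracket_apply]
  abel

/-- The first Bianchi identity. -/
theorem extCurv_bianchi {μ : BracketSpace k p} (hμ : IsHomogeneous μ)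
    {Λ : p →ₗ[ℝ] p →ₗ[ℝ] p} (hΛ : ∀ X Y, Λ X Y - Λ Y X = pBracket μ X Y) (x y z : k × p) :
    extCurv μ Λ x y z.2 + extCurv μ Λ y z x.2 + extCurv μ Λ z x y.2 = 0 := by
  have T := extConn_torsion hμ hΛ
  have J := congrArg Prod.snd (hμ.jacobi x y z)
  simp only [Prod.snd_add, Prod.snd_zero] at J
  rw [← T x (μ y z), ← T y (μ z x), ← T z (μ x y), ← T y z, ← T z x, ← T x y] at J
  simp only [extCurv_apply]
  simp only [map_sub] at J
  rw [← J]
  abel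

theorem extConn_skew {μ : BracketSpace k p} (hμ : IsHomogeneous μ)
    {Λ : p →ₗ[ℝ] p →ₗ[ℝ] p} (hΛ : IsLeviCivita μ (innerₗ p) Λ) (x : k × p) (V W : p) :
    ⟪extConn μ Λ x V, W⟫ = -⟪V, extConn μ Λ x W⟫ := by
  have h := hΛ.metric x.2 V W
  simp only [innerₗ_apply_apply] at h
  rw [extConn_apply, LinearMap.add_apply, LinearMap.add_apply, inner_add_left, inner_add_right,
    hμ.skew]
  linarith

theorem extCurv_skew {μ : BracketSpace k p} (hμ : IsHomogeneous μ)
    {Λ : p →ₗ[ℝ] p →ₗ[ℝ] p} (hΛ : IsLeviCivita μ (innerₗ p) Λ) (x y : k × p) (V W : p) :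
    ⟪extCurv μ Λ x y V, W⟫ = -⟪V, extCurv μ Λ x y W⟫ := by
  have h := extConn_skew hμ hΛ
  simp only [extCurv_apply, inner_sub_left, inner_sub_right, h _ (extConn _ _ _ _), h _ V]
  simp only [← h _ _ (extConn _ _ _ _)]
  simp only [h _ V, neg_neg]
  ring

/-- The extended curvature is horizontal.  By the Bianchi identity `(Y, V) ↦ R(Z, Y)V` is symmetric
for `Z ∈ 𝔨`, and a trilinear form symmetric in one pair of arguments and skew in an overlapping
pair vanishes. -/
theorem extCurv_isotropy_left {μ : BracketSpace k p} (hμ : IsHomogeneous μ)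
    {Λ : p →ₗ[ℝ] p →ₗ[ℝ] p} (hΛ : IsLeviCivita μ (innerₗ p) Λ) (Z : k) (y : k × p) :
    extCurv μ Λ (Z, 0) y = 0 := by
  have hsymm : ∀ y z : k × p, extCurv μ Λ (Z, 0) y z.2 = extCurv μ Λ (Z, 0) z y.2 := by
    intro y z
    have h := extCurv_bianchi hμ hΛ.torsion_free (Z, 0) y z
    rw [extCurv_swap hμ.alt Λ z, LinearMap.neg_apply] at h
    simp only [map_zero, add_zero] at h
    exact sub_eq_zero.1 (by rw [sub_eq_add_neg]; exact h)
  have hskew := extCurv_skew hμ hΛ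
  ext V
  refine ext_inner_right ℝ fun W => ?_
  obtain ⟨U, Y⟩ := y
  have e1 : ∀ A B : p, extCurv μ Λ (Z, 0) (U, A) B = extCurv μ Λ (Z, 0) (0, B) A :=
    fun A B => hsymm (U, A) (0, B)
  have e2 : ∀ A B : p, extCurv μ Λ (Z, 0) (0, A) B = extCurv μ Λ (Z, 0) (0, B) A :=
    fun A B => hsymm (0, A) (0, B)
  rw [e1, LinearMap.zero_apply, inner_zero_left]
  -- Alternating the symmetry and the skewness three times around gives `⟪R(Z, V)Y, W⟫` back with
  -- the opposite sign.
  have a1 := hskew (Z, 0) (0, V) Y W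
  have a2 := hskew (Z, 0) (0, W) V Y
  have a3 := hskew (Z, 0) (0, Y) W V
  rw [e2 V W, real_inner_comm] at a1
  rw [e2 W Y, real_inner_comm] at a2
  rw [e2 Y V, real_inner_comm] at a3
  rw [real_inner_comm]
  linarith

/-- The curvature on `𝔤` descends to `𝔤/𝔨`. -/
theorem extCurv_eq_curvature {μ : BracketSpace k p} (hμ : IsHomogeneous μ)
    {Λ : p →ₗ[ℝ] p →ₗ[ℝ] p} (hΛ : IsLeviCivita μ (innerₗ p) Λ) (x y : k × p) :
    extCurv μ Λ x y = curvature μ Λ x.2 y.2 := by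
  have hadd : ∀ x x' y, extCurv μ Λ (x + x') y = extCurv μ Λ x y + extCurv μ Λ x' y := by
    intro x x' y
    ext V
    simp only [extCurv_apply, map_add, LinearMap.add_apply]
    abel
  have hl : ∀ x y, extCurv μ Λ x y = extCurv μ Λ (0, x.2) y := by
    intro x y
    have hx : x = (x.1, 0) + (0, x.2) := by simp
    conv_lhs => rw [hx, hadd, extCurv_isotropy_left hμ hΛ, zero_add]
  rw [curvature_eq_extCurv, hl x y, extCurv_swap hμ.alt, hl y, ← extCurv_swap hμ.alt]

/-! ### The Ricci tensor: symmetry and naturality -/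

theorem innerₗ_pos (X : p) (hX : X ≠ 0) : 0 < innerₗ p X X := by
  rw [innerₗ_apply_apply]
  exact real_inner_self_pos.2 hX

/-- The endomorphism `Z ↦ R(Z, X)Y`, whose trace is the Ricci tensor. -/
def ricciEnd (μ : BracketSpace k p) (Λ : p →ₗ[ℝ] p →ₗ[ℝ] p) (X Y : p) : p →ₗ[ℝ] p where
  toFun Z := curvature μ Λ Z X Y
  map_add' := by intros; simp [curvature]; abel
  map_smul' := by intros; simp [curvature, smul_sub]

theorem ricciTensor_apply (μ : BracketSpace k p) (g : p →ₗ[ℝ] p →ₗ[ℝ] ℝ) (X Y : p) :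
    ricciTensor μ g X Y = LinearMap.trace ℝ p (ricciEnd μ (leviCivita μ g) X Y) := rfl

theorem ricciTensor_smul_metric (μ : BracketSpace k p) (g : p →ₗ[ℝ] p →ₗ[ℝ] ℝ) {a : ℝ}
    (ha : a ≠ 0) : ricciTensor μ (a • g) = ricciTensor μ g := by
  have h : ∀ Λ, IsLeviCivita μ (a • g) Λ ↔ IsLeviCivita μ g Λ := by
    intro Λ
    refine ⟨fun h => ⟨h.torsion_free, fun X Y Z => ?_⟩, fun h => ⟨h.torsion_free, fun X Y Z => ?_⟩⟩
    · have := h.metric X Y Z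
      simp only [LinearMap.smul_apply, smul_eq_mul, ← mul_add] at this
      exact (mul_eq_zero.1 this).resolve_left ha
    · simp only [LinearMap.smul_apply, smul_eq_mul, ← mul_add, h.metric, mul_zero]
  have h' : leviCivita μ (a • g) = leviCivita μ g := by
    classical
    exact congrArg (fun P : (p →ₗ[ℝ] p →ₗ[ℝ] p) → Prop => if h : ∃ Λ, P Λ then h.choose else 0)
      (funext fun Λ => propext (h Λ))
  ext X Y
  rw [ricciTensor_apply, ricciTensor_apply, h']

variable [FiniteDimensional ℝ p]

theorem isLeviCivita_standard {μ : BracketSpace k p} (hμ : ∀ x, μ x x = 0) :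
    IsLeviCivita μ (innerₗ p) (leviCivita μ (innerₗ p)) :=
  isLeviCivita_leviCivita _ _ (existsUnique_isLeviCivita μ hμ _
    (fun X Y => real_inner_comm Y X) innerₗ_pos).exists

theorem eq_leviCivita {μ : BracketSpace k p} (hμ : ∀ x, μ x x = 0) {g : p →ₗ[ℝ] p →ₗ[ℝ] ℝ}
    (hsymm : ∀ X Y, g X Y = g Y X) (hpos : ∀ X, X ≠ 0 → 0 < g X X) {Λ : p →ₗ[ℝ] p →ₗ[ℝ] p}
    (hΛ : IsLeviCivita μ g Λ) : leviCivita μ g = Λ :=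
  have h := existsUnique_isLeviCivita μ hμ g hsymm hpos
  h.unique (isLeviCivita_leviCivita μ g h.exists) hΛ

theorem ricciTensor_eq_sum (μ : BracketSpace k p) (g : p →ₗ[ℝ] p →ₗ[ℝ] ℝ) (X Y : p) :
    ricciTensor μ g X Y = ∑ i, ⟪stdOrthonormalBasis ℝ p i,
      curvature μ (leviCivita μ g) (stdOrthonormalBasis ℝ p i) X Y⟫ := by
  rw [ricciTensor_apply, LinearMap.trace_eq_sum_inner _ (stdOrthonormalBasis ℝ p)]
  rfl

/-- By the Bianchi identity `ric(X, Y) - ric(Y, X)` is minus the trace of `R(X, Y)`, which is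
skew-symmetric. -/
theorem ricciTensor_symm {μ : BracketSpace k p} (hμ : IsHomogeneous μ) (X Y : p) :
    ricciTensor μ (innerₗ p) X Y = ricciTensor μ (innerₗ p) Y X := by
  have hΛ := isLeviCivita_standard hμ.alt
  rw [← sub_eq_zero, ricciTensor_eq_sum, ricciTensor_eq_sum, ← Finset.sum_sub_distrib]
  refine Finset.sum_eq_zero fun i _ => ?_
  set e := stdOrthonormalBasis ℝ p i
  set Λ := leviCivita μ (innerₗ p)
  have hb := extCurv_bianchi hμ hΛ.torsion_free (0, e) (0, X) (0, Y)
  have hs := extCurv_skew hμ hΛ (0, X) (0, Y) e e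
  rw [extCurv_swap hμ.alt Λ (0, Y) (0, e), LinearMap.neg_apply] at hb
  have hb' : extCurv μ Λ (0, e) (0, X) Y - extCurv μ Λ (0, e) (0, Y) X =
      -extCurv μ Λ (0, X) (0, Y) e := by
    rw [← sub_eq_zero, ← hb]; abel
  rw [curvature_eq_extCurv, curvature_eq_extCurv, ← inner_sub_right, hb', inner_neg_right]
  rw [real_inner_comm] at hs
  linarith

/-- Naturality of the Ricci tensor.  The map `φ` need not preserve the complement `𝔭` of `𝔨`: only
the map `e` that it induces on `𝔤/𝔨 = 𝔭` matters. -/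
theorem ricciTensor_pullback {μ μ' : BracketSpace k p} (hμ : ∀ x, μ x x = 0)
    (hμ' : IsHomogeneous μ') (φ : (k × p) →ₗ[ℝ] (k × p)) (e : p ≃ₗ[ℝ] p)
    (hφ : ∀ x y, φ (μ x y) = μ' (φ x) (φ y)) (he : ∀ x, (φ x).2 = e x.2) (X Y : p) :
    ricciTensor μ ((innerₗ p).compl₁₂ e.toLinearMap e.toLinearMap) X Y =
      ricciTensor μ' (innerₗ p) (e X) (e Y) := by
  set g := (innerₗ p).compl₁₂ e.toLinearMap e.toLinearMap with hg
  have hgX : ∀ X Y, g X Y = ⟪e X, e Y⟫ := fun _ _ => rfl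
  set Λ' := leviCivita μ' (innerₗ p) with hΛ'def
  have hΛ' : IsLeviCivita μ' (innerₗ p) Λ' := isLeviCivita_standard hμ'.alt
  -- The pullback of the extended connection along `φ`; by uniqueness it is the Levi-Civita
  -- connection of the pulled-back metric.
  let Λe : p →ₗ[ℝ] p →ₗ[ℝ] p :=
    ((extConn μ' Λ' ∘ₗ φ ∘ₗ LinearMap.inr ℝ k p).compl₂ e.toLinearMap).compr₂ e.symm.toLinearMap
  have hΛe : ∀ X Y, Λe X Y = e.symm (extConn μ' Λ' (φ (0, X)) (e Y)) := fun _ _ => rfl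
  have hLC : IsLeviCivita μ g Λe := by
    constructor
    · intro X Y
      apply e.injective
      rw [map_sub, hΛe, hΛe, e.apply_symm_apply, e.apply_symm_apply, pBracket_apply, ← he, hφ,
        ← extConn_torsion hμ' hΛ'.torsion_free, he, he]
    · intro X Y Z
      rw [hgX, hgX, hΛe, hΛe, e.apply_symm_apply, e.apply_symm_apply, extConn_skew hμ' hΛ']
      ring
  have hΛ : leviCivita μ g = Λe := by
    refine eq_leviCivita hμ (fun X Y => real_inner_comm _ _) (fun X hX => ?_) hLC
    exact innerₗ_pos _ (by simpa using hX)
  have hconn : ∀ x V, e (extConn μ Λe x V) = extConn μ' Λ' (φ x) (e V) := by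
    intro x V
    have hx : φ x = φ (x.1, 0) + φ (0, x.2) := by rw [← map_add]; simp
    rw [hx, map_add, LinearMap.add_apply, extConn_apply, LinearMap.add_apply, map_add, hΛe,
      e.apply_symm_apply, isotropy_apply]
    congr 1
    have h2 : (φ (x.1, 0)).2 = 0 := by rw [he, map_zero]
    rw [← he, hφ, ← extConn_torsion hμ' hΛ'.torsion_free, h2, map_zero, sub_zero, he]
  -- Here `φ (0, Z)` need not lie in `𝔭`, but the extended curvature only sees its `𝔭`-component.
  have hcurv : ∀ Z X Y, curvature μ Λe Z X Y = e.symm (curvature μ' Λ' (e Z) (e X) (e Y)) := by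
    intro Z X Y
    apply e.injective
    have hz : ∀ Z : p, e Z = (φ (0, Z)).2 := fun Z => (he (0, Z)).symm
    rw [e.apply_symm_apply, hz Z, hz X, ← extCurv_eq_curvature hμ' hΛ', curvature_eq_extCurv]
    simp only [extCurv_apply, map_sub, hconn, hφ]
  rw [ricciTensor_apply, ricciTensor_apply, hΛ, ← hΛ'def]
  have : ricciEnd μ Λe X Y = e.symm.conj (ricciEnd μ' Λ' (e X) (e Y)) := by
    ext Z
    rw [LinearEquiv.conj_apply_apply, LinearEquiv.symm_symm]
    exact hcurv Z X Y
  rw [this, LinearMap.trace_conj']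

theorem adjoint_ricciOperator {μ : BracketSpace k p} (hμ : IsHomogeneous μ) :
    LinearMap.adjoint (ricciOperator μ) = ricciOperator μ := by
  symm
  rw [LinearMap.eq_adjoint_iff]
  intro X Y
  rw [inner_ricciOperator, ricciTensor_symm hμ, ← inner_ricciOperator, real_inner_comm]

end

section

/-! ### One-parameter groups of endomorphisms -/

section LinExp

variable {V W U : Type*} [NormedAddCommGroup V] [NormedSpace ℝ V] [FiniteDimensional ℝ V]
  [NormedAddCommGroup W] [NormedSpace ℝ W] [NormedAddCommGroup U] [NormedSpace ℝ U]

theorem hasDerivAt_linearMap_comp (L : V →ₗ[ℝ] W) {f : ℝ → V} {f' : V} {t : ℝ}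
    (hf : HasDerivAt f f' t) : HasDerivAt (fun τ => L (f τ)) (L f') t :=
  (LinearMap.toContinuousLinearMap L).hasFDerivAt.comp_hasDerivAt t hf

theorem hasDerivAt_bilinearMap_comp [FiniteDimensional ℝ W] (B : V →ₗ[ℝ] W →ₗ[ℝ] U)
    {f : ℝ → V} {f' : V} {g : ℝ → W} {g' : W} {t : ℝ}
    (hf : HasDerivAt f f' t) (hg : HasDerivAt g g' t) :
    HasDerivAt (fun τ => B (f τ) (g τ)) (B f' (g t) + B (f t) g') t :=
  (B.toContinuousBilinearMap.hasFDerivAt.comp_hasDerivAt t hf).clm_apply hg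

/-- The exponential of an endomorphism of a finite-dimensional normed space; on `𝔭` it is
`expEnd`. -/
noncomputable def linExp (T : V →ₗ[ℝ] V) : V →ₗ[ℝ] V :=
  (NormedSpace.exp (LinearMap.toContinuousLinearMap T) : V →L[ℝ] V)

theorem linExp_zero : linExp (0 : V →ₗ[ℝ] V) = LinearMap.id := by
  simp only [linExp, map_zero, NormedSpace.exp_zero]
  rfl

theorem linExp_neg_apply (T : V →ₗ[ℝ] V) (x : V) : linExp (-T) (linExp T x) = x := by
  have : CompleteSpace V := FiniteDimensional.complete ℝ V
  let _ : NormedAlgebra ℚ (V →L[ℝ] V) := NormedAlgebra.restrictScalars ℚ ℝ _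
  have h := NormedSpace.exp_add_of_commute
    ((Commute.refl (LinearMap.toContinuousLinearMap T)).neg_left)
  rw [neg_add_cancel, NormedSpace.exp_zero] at h
  have h' := congrArg (fun F : V →L[ℝ] V => F x) h
  simp only [linExp, map_neg]
  exact h'.symm

theorem linExp_apply_neg (T : V →ₗ[ℝ] V) (x : V) : linExp T (linExp (-T) x) = x := by
  have := linExp_neg_apply (-T) x
  rwa [neg_neg] at this

/-- The exponential as a linear automorphism. -/
noncomputable def linExpEquiv (T : V →ₗ[ℝ] V) : V ≃ₗ[ℝ] V where
  toLinearMap := linExp T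
  invFun := linExp (-T)
  left_inv := linExp_neg_apply T
  right_inv := linExp_apply_neg T

theorem apply_linExp_smul (T : V →ₗ[ℝ] V) (t : ℝ) (x : V) :
    T (linExp (t • T) x) = linExp (t • T) (T x) := by
  have h : Commute (LinearMap.toContinuousLinearMap T)
      (NormedSpace.exp (t • LinearMap.toContinuousLinearMap T)) :=
    ((Commute.refl _).smul_right t).exp_right
  have h' := congrArg (fun F : V →L[ℝ] V => F x) h.eq
  simp only [linExp, map_smul]
  exact h'

/-- The product rule for `e^{σ(t)T} f(t)`. -/
theorem hasDerivAt_linExp (T : V →ₗ[ℝ] V) {σ : ℝ → ℝ} {σ' t : ℝ} (hσ : HasDerivAt σ σ' t)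
    {f : ℝ → V} {f' : V} (hf : HasDerivAt f f' t) :
    HasDerivAt (fun τ => linExp (σ τ • T) (f τ)) (linExp (σ t • T) (σ' • T (f t) + f')) t := by
  have : CompleteSpace V := FiniteDimensional.complete ℝ V
  have h := (hasDerivAt_exp_smul_const (LinearMap.toContinuousLinearMap T) (σ t)).scomp t hσ
  have h' := h.clm_apply hf
  refine (HasDerivAt.congr_deriv h' ?_).congr_of_eventuallyEq (Filter.Eventually.of_forall ?_)
  · simp only [linExp, map_add, map_smul]
    rfl
  · intro τ
    simp only [linExp, map_smul]
    rfl

theorem hasDerivAt_linExp_apply (T : V →ₗ[ℝ] V) (x : V) (t : ℝ) :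
    HasDerivAt (fun τ => linExp (τ • T) x) (T (linExp (t • T) x)) t := by
  have h := hasDerivAt_linExp T (hasDerivAt_id t) (hasDerivAt_const t x)
  simp only [id_eq, one_smul, add_zero] at h
  rwa [apply_linExp_smul]

/-- Uniqueness of solutions of the linear equation `f' = T f`. -/
theorem eq_linExp_of_hasDerivAt (T : V →ₗ[ℝ] V) {f : ℝ → V}
    (hf : ∀ t, HasDerivAt f (T (f t)) t) (t : ℝ) : f t = linExp (t • T) (f 0) := by
  have hF : ∀ t, HasDerivAt (fun τ => linExp ((-τ) • T) (f τ)) 0 t := by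
    intro t
    refine (hasDerivAt_linExp T (hasDerivAt_neg t) (hf t)).congr_deriv ?_
    rw [neg_one_smul, neg_add_cancel, map_zero]
  have h := is_const_of_deriv_eq_zero (fun t => (hF t).differentiableAt)
    (fun t => (hF t).deriv) t 0
  simp only [neg_zero, zero_smul, linExp_zero, LinearMap.id_apply] at h
  rw [← h, neg_smul, linExp_apply_neg]

/-- A linear map intertwining two endomorphisms intertwines their exponentials. -/
theorem map_linExp_smul [FiniteDimensional ℝ W] (L : V →ₗ[ℝ] W) (T : V →ₗ[ℝ] V) (T' : W →ₗ[ℝ] W)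
    (h : ∀ x, L (T x) = T' (L x)) (t : ℝ) (x : V) :
    L (linExp (t • T) x) = linExp (t • T') (L x) := by
  have h1 := eq_linExp_of_hasDerivAt T' (f := fun t => L (linExp (t • T) x)) (fun t => by
    rw [← h]
    exact hasDerivAt_linearMap_comp L (hasDerivAt_linExp_apply T x t)) t
  rwa [zero_smul, linExp_zero] at h1

/-- The exponential of a derivation is an automorphism. -/
theorem linExp_smul_derivation (μ : V →ₗ[ℝ] V →ₗ[ℝ] V) (D : V →ₗ[ℝ] V)
    (h : ∀ x y, D (μ x y) = μ (D x) y + μ x (D y)) (t : ℝ) (x y : V) :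
    linExp (t • D) (μ x y) = μ (linExp (t • D) x) (linExp (t • D) y) := by
  have h1 := eq_linExp_of_hasDerivAt D
    (f := fun t => μ (linExp (t • D) x) (linExp (t • D) y)) (fun t => by
    rw [h]
    exact hasDerivAt_bilinearMap_comp μ (hasDerivAt_linExp_apply D x t)
      (hasDerivAt_linExp_apply D y t)) t
  simp only [zero_smul, linExp_zero, LinearMap.id_apply] at h1
  exact h1.symm

end LinExp

/-- The exponential of a skew-symmetric endomorphism is orthogonal. -/
theorem inner_linExp_smul_skew {V : Type*} [NormedAddCommGroup V] [InnerProductSpace ℝ V]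
    [FiniteDimensional ℝ V] (A : V →ₗ[ℝ] V) (hA : ∀ X Y, ⟪A X, Y⟫ = -⟪X, A Y⟫) (t : ℝ) (X Y : V) :
    ⟪linExp (t • A) X, linExp (t • A) Y⟫ = ⟪X, Y⟫ := by
  have hF : ∀ t, HasDerivAt (fun τ : ℝ => innerₗ V (linExp (τ • A) X) (linExp (τ • A) Y)) 0 t := by
    intro t
    refine (hasDerivAt_bilinearMap_comp (innerₗ V) (hasDerivAt_linExp_apply A X t)
      (hasDerivAt_linExp_apply A Y t)).congr_deriv ?_
    simp only [innerₗ_apply_apply, hA]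
    exact neg_add_cancel _
  have h := is_const_of_deriv_eq_zero (fun t => (hF t).differentiableAt)
    (fun t => (hF t).deriv) t 0
  simpa only [zero_smul, linExp_zero, LinearMap.id_apply, innerₗ_apply_apply] using h

end

section

variable {k p : Type*} [NormedAddCommGroup k] [NormedSpace ℝ k]
  [NormedAddCommGroup p] [InnerProductSpace ℝ p]

/-! ### The action of the linear group on brackets -/

theorem act_equiv_apply (e : (k × p) ≃ₗ[ℝ] (k × p)) (μ : BracketSpace k p) (x y : k × p) :
    act e.toLinearMap μ x y = e (μ (e.symm x) (e.symm y)) := by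
  let u : (Module.End ℝ (k × p))ˣ :=
    ⟨e.toLinearMap, e.symm.toLinearMap, by ext <;> simp, by ext <;> simp⟩
  have h : Ring.inverse (M₀ := Module.End ℝ (k × p)) e.toLinearMap = e.symm.toLinearMap :=
    Ring.inverse_unit u
  simp only [act, h]
  rfl

/-- The automorphism `diag(I, q)` of `𝔤 = 𝔨 ⊕ 𝔭`. -/
def diagEquiv (k : Type*) [NormedAddCommGroup k] [NormedSpace ℝ k] (q : p ≃ₗ[ℝ] p) :
    (k × p) ≃ₗ[ℝ] (k × p) :=
  (LinearEquiv.refl ℝ k).prodCongr q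

theorem diagEquiv_apply (q : p ≃ₗ[ℝ] p) (x : k × p) : diagEquiv k q x = (x.1, q x.2) := rfl

theorem diagEquiv_symm_apply (q : p ≃ₗ[ℝ] p) (x : k × p) :
    (diagEquiv k q).symm x = (x.1, q.symm x.2) := rfl

theorem isotropy_act_diagEquiv (μ : BracketSpace k p) (q : p ≃ₗ[ℝ] p) (Z : k) (X : p) :
    isotropy (act (diagEquiv k q).toLinearMap μ) Z X = q (isotropy μ Z (q.symm X)) := by
  simp only [isotropy_apply, act_equiv_apply, diagEquiv_symm_apply, diagEquiv_apply, map_zero]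

theorem IsHomogeneous.act_diagEquiv {μ : BracketSpace k p} (hμ : IsHomogeneous μ)
    (q : p ≃ₗ[ℝ] p) (hq : ∀ Z X, q (isotropy μ Z X) = isotropy μ Z (q X)) :
    IsHomogeneous (act (diagEquiv k q).toLinearMap μ) where
  alt x := by rw [act_equiv_apply, hμ.alt, map_zero]
  jacobi x y z := by
    simp only [act_equiv_apply, LinearEquiv.symm_apply_apply]
    rw [← map_add, ← map_add, hμ.jacobi, map_zero]
  k_subalgebra Z W := by
    simp only [act_equiv_apply, diagEquiv_symm_apply, diagEquiv_apply, map_zero, hμ.k_subalgebra]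
  reductive Z X := by
    simp only [act_equiv_apply, diagEquiv_symm_apply, diagEquiv_apply, map_zero, hμ.reductive]
  skew Z X Y := by
    simp only [isotropy_act_diagEquiv, hq, LinearEquiv.apply_symm_apply, hμ.skew]
  almost_effective Z hZ := by
    refine hμ.almost_effective Z fun X => ?_
    have h := hZ (q X)
    rw [act_equiv_apply] at h
    simpa only [diagEquiv_symm_apply, map_zero, LinearEquiv.symm_apply_apply,
      LinearEquiv.map_eq_zero_iff] using h

theorem neg_rep_diag (N : p →ₗ[ℝ] p) (μ : BracketSpace k p) (x y : k × p) :
    -rep (diag 0 N) μ x y = rep (diag 0 (-N)) μ x y := by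
  have h : ∀ v : k × p, diag 0 (-N) v = -diag (0 : k →ₗ[ℝ] k) N v := by
    intro v
    ext <;> simp
  simp only [rep, h, map_neg, LinearMap.neg_apply]
  abel

/-- Along a curve `diag(I, q(t))·μ`, where `q' = N q`, the bracket moves with velocity
`π(diag(0, N))`.  The hypothesis on `q` is the product rule for `q(t) f(t)`. -/
theorem hasDerivAt_of_eq_diag [FiniteDimensional ℝ k] [FiniteDimensional ℝ p]
    (μ : BracketSpace k p) (ν : ℝ → BracketSpace k p) (q qi : ℝ → p →ₗ[ℝ] p) (N : p →ₗ[ℝ] p) (t : ℝ)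
    (hν : ∀ᶠ τ in nhds t, ∀ x y, ν τ x y = diag LinearMap.id (q τ)
      (μ (diag LinearMap.id (qi τ) x) (diag LinearMap.id (qi τ) y)))
    (hq : ∀ (f : ℝ → p) (f' : p), HasDerivAt f f' t →
      HasDerivAt (fun τ => q τ (f τ)) (q t f' + N (q t (f t))) t)
    (hqi : ∀ X, HasDerivAt (fun τ => qi τ X) (-qi t (N X)) t) (x y : k × p) :
    HasDerivAt (fun τ => ν τ x y) (rep (diag 0 N) (ν t) x y) t := by
  have hi : ∀ x : k × p, HasDerivAt (fun τ => diag LinearMap.id (qi τ) x)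
      (-diag LinearMap.id (qi t) (diag 0 N x)) t := by
    intro x
    refine ((hasDerivAt_const t x.1).prodMk (hqi x.2)).congr_deriv ?_
    ext <;> simp
  have hb := hasDerivAt_bilinearMap_comp μ (hi x) (hi y)
  simp only [map_neg, LinearMap.neg_apply] at hb
  have h1 := hasDerivAt_linearMap_comp (LinearMap.fst ℝ k p) hb
  have h2 := hq _ _ (hasDerivAt_linearMap_comp (LinearMap.snd ℝ k p) hb)
  refine ((h1.prodMk h2).congr_deriv ?_).congr_of_eventuallyEq (hν.mono fun τ h => h x y)
  have hν' := hν.self_of_nhds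
  simp only [rep, hν']
  ext
  · simp
    abel
  · simp
    abel

theorem IsDerivationKilling.pPart_apply {μ : BracketSpace k p} {D : (k × p) →ₗ[ℝ] (k × p)}
    (hD : IsDerivationKilling μ D) (x : k × p) : (D x).2 = pPart D x.2 := by
  have hx : x = (x.1, 0) + (0, x.2) := by simp
  rw [hx, map_add, hD.apply_k]
  simp [pPart]

theorem IsDerivationKilling.pPart_isotropy {μ : BracketSpace k p} (hμ : IsHomogeneous μ)
    {D : (k × p) →ₗ[ℝ] (k × p)} (hD : IsDerivationKilling μ D) (Z : k) (X : p) :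
    pPart D (isotropy μ Z X) = isotropy μ Z (pPart D X) := by
  have h := congrArg Prod.snd (hD.leibniz (Z, 0) (0, X))
  rw [hD.pPart_apply, hD.apply_k, map_zero, LinearMap.zero_apply, zero_add] at h
  have hx : D (0, X) = ((D (0, X)).1, 0) + (0, pPart D X) := by simp [pPart]
  rw [hx, map_add, Prod.snd_add, hμ.k_subalgebra, zero_add] at h
  exact h

variable [FiniteDimensional ℝ p]

theorem skewPart_skew (T : p →ₗ[ℝ] p) (X Y : p) : ⟪skewPart T X, Y⟫ = -⟪X, skewPart T Y⟫ := by
  simp only [skewPart, LinearMap.smul_apply, LinearMap.sub_apply, real_inner_smul_left,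
    real_inner_smul_right, inner_sub_left, inner_sub_right, LinearMap.adjoint_inner_left,
    LinearMap.adjoint_inner_right]
  ring

theorem sub_skewPart (T : p →ₗ[ℝ] p) (X : p) : T X - skewPart T X = symPart T X := by
  simp only [skewPart, symPart, LinearMap.smul_apply, LinearMap.sub_apply, LinearMap.add_apply]
  module

theorem skewPart_isotropy {μ : BracketSpace k p} (hμ : IsHomogeneous μ) {T : p →ₗ[ℝ] p}
    (hT : ∀ Z X, T (isotropy μ Z X) = isotropy μ Z (T X)) (Z : k) (X : p) :
    skewPart T (isotropy μ Z X) = isotropy μ Z (skewPart T X) := by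
  have h : LinearMap.adjoint T (isotropy μ Z X) = isotropy μ Z (LinearMap.adjoint T X) := by
    refine ext_inner_right ℝ fun Y => ?_
    rw [LinearMap.adjoint_inner_left, hμ.skew, ← hT, hμ.skew, LinearMap.adjoint_inner_left]
  simp only [skewPart, LinearMap.smul_apply, LinearMap.sub_apply, hT, h, map_smul, map_sub]

/-! ### The soliton curve -/

theorem isOpen_timeInterval (c : ℝ) : IsOpen (timeInterval c) :=
  isOpen_lt continuous_const (by fun_prop)

theorem zero_mem_timeInterval (c : ℝ) : (0 : ℝ) ∈ timeInterval c := by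
  simp [timeInterval]

theorem sTime_zero (c : ℝ) : sTime c 0 = 0 := by
  simp [sTime]

theorem hasDerivAt_sTime {c t : ℝ} (ht : t ∈ timeInterval c) :
    HasDerivAt (sTime c) (-2 * c * t + 1)⁻¹ t := by
  have ht' : 0 < -2 * c * t + 1 := ht
  by_cases hc : c = 0
  · subst hc
    have : sTime 0 = id := by ext; simp [sTime]
    rw [this]
    simpa using hasDerivAt_id t
  · have : sTime c = fun t => -(1 / (2 * c)) * Real.log (-2 * c * t + 1) := by
      ext t; simp [sTime, hc]
    rw [this]
    have h1 : HasDerivAt (fun t : ℝ => -2 * c * t + 1) (-2 * c) t := by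
      simpa using ((hasDerivAt_id t).const_mul (-2 * c)).add_const 1
    refine ((h1.log ht'.ne').const_mul _).congr_deriv ?_
    field_simp

theorem hasDerivAt_sqrt_time {c t : ℝ} (ht : t ∈ timeInterval c) :
    HasDerivAt (fun τ => √(-2 * c * τ + 1)) (-c * (-2 * c * t + 1)⁻¹ * √(-2 * c * t + 1)) t := by
  have ht' : 0 < -2 * c * t + 1 := ht
  have h1 : HasDerivAt (fun t : ℝ => -2 * c * t + 1) (-2 * c) t := by
    simpa using ((hasDerivAt_id t).const_mul (-2 * c)).add_const 1
  refine (h1.sqrt ht'.ne').congr_deriv ?_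
  have h2 : (-2 * c * t + 1) = √(-2 * c * t + 1) * √(-2 * c * t + 1) :=
    (Real.mul_self_sqrt ht'.le).symm
  have h3 : 0 < √(-2 * c * t + 1) := Real.sqrt_pos.2 ht'
  set ρ := √(-2 * c * t + 1)
  rw [h2]
  field_simp

/-- The automorphism `q(t) = (-2ct+1)^{1/2} e^{s(t)A} e^{-s(t)T}` of `𝔭`, with `A` the
skew-symmetric part of `T`; the soliton curve is `diag(I, q(t))·μ₀`. -/
noncomputable def solitonEquiv (T : p →ₗ[ℝ] p) {c t : ℝ} (ht : t ∈ timeInterval c) : p ≃ₗ[ℝ] p :=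
  linExpEquiv ((-sTime c t) • T) ≪≫ₗ linExpEquiv (sTime c t • skewPart T) ≪≫ₗ
    LinearEquiv.smulOfNeZero ℝ p (√(-2 * c * t + 1)) (Real.sqrt_pos.2 ht).ne'

theorem solitonEquiv_apply (T : p →ₗ[ℝ] p) {c t : ℝ} (ht : t ∈ timeInterval c) (X : p) :
    solitonEquiv T ht X = √(-2 * c * t + 1) •
      linExp (sTime c t • skewPart T) (linExp ((-sTime c t) • T) X) := rfl

theorem solitonEquiv_symm_apply (T : p →ₗ[ℝ] p) {c t : ℝ} (ht : t ∈ timeInterval c) (X : p) :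
    (solitonEquiv T ht).symm X = (√(-2 * c * t + 1))⁻¹ •
      linExp (sTime c t • T) (linExp ((-sTime c t) • skewPart T) X) := by
  rw [LinearEquiv.symm_apply_eq, solitonEquiv_apply, map_smul, map_smul, smul_smul,
    mul_inv_cancel₀ (Real.sqrt_pos.2 ht).ne', one_smul, neg_smul, neg_smul, linExp_neg_apply,
    linExp_apply_neg]

theorem solitonCurve_eq_act (μ : BracketSpace k p) (D : (k × p) →ₗ[ℝ] (k × p)) {c t : ℝ}
    (ht : t ∈ timeInterval c) :
    solitonCurve μ c D t = act (diagEquiv k (solitonEquiv (pPart D) ht)).toLinearMap μ := by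
  have ht' : 0 < -2 * c * t + 1 := ht
  have hr : ((-2 * c * t + 1) ^ (-(1 / 2) : ℝ))⁻¹ = √(-2 * c * t + 1) := by
    rw [Real.rpow_neg ht'.le, inv_inv, Real.sqrt_eq_rpow]
  let q₁ : p ≃ₗ[ℝ] p :=
    linExpEquiv ((-sTime c t) • pPart D) ≪≫ₗ linExpEquiv (sTime c t • skewPart (pPart D))
  let q₂ : p ≃ₗ[ℝ] p :=
    LinearEquiv.smulOfNeZero ℝ p (√(-2 * c * t + 1)) (Real.sqrt_pos.2 ht).ne'
  have h1 : diag LinearMap.id (expEnd (sTime c t • skewPart (pPart D)) ∘ₗ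
      expEnd (-(sTime c t) • pPart D)) = (diagEquiv k q₁).toLinearMap := rfl
  have h2 : diag LinearMap.id (√(-2 * c * t + 1) • LinearMap.id) =
      (diagEquiv k q₂).toLinearMap := rfl
  rw [solitonCurve, rescale, hr, h1, h2]
  refine LinearMap.ext fun x => LinearMap.ext fun y => ?_
  simp only [act_equiv_apply]
  rfl

/-- The velocity of the soliton curve, for any endomorphism `D` of `𝔤`. -/
theorem hasDerivAt_solitonCurve [FiniteDimensional ℝ k] (μ : BracketSpace k p)
    (D : (k × p) →ₗ[ℝ] (k × p)) {c t : ℝ} (ht : t ∈ timeInterval c) (N : p →ₗ[ℝ] p)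
    (hN : ∀ X, N (linExp (sTime c t • skewPart (pPart D)) X) =
      -(-2 * c * t + 1)⁻¹ • linExp (sTime c t • skewPart (pPart D)) (c • X + symPart (pPart D) X))
    (x y : k × p) :
    HasDerivAt (fun τ => solitonCurve μ c D τ x y)
      (rep (diag 0 N) (solitonCurve μ c D t) x y) t := by
  set T := pPart D with hT
  set A := skewPart T with hA
  let q : ℝ → p →ₗ[ℝ] p := fun τ => √(-2 * c * τ + 1) •
    (linExp (sTime c τ • A) ∘ₗ linExp ((-sTime c τ) • T))
  let qi : ℝ → p →ₗ[ℝ] p := fun τ => (√(-2 * c * τ + 1))⁻¹ •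
    (linExp (sTime c τ • T) ∘ₗ linExp ((-sTime c τ) • A))
  have hs := hasDerivAt_sTime ht
  have hρ := hasDerivAt_sqrt_time ht
  have hρ0 : √(-2 * c * t + 1) ≠ 0 := (Real.sqrt_pos.2 ht).ne'
  refine hasDerivAt_of_eq_diag μ _ q qi N t ?_ ?_ ?_ x y
  · filter_upwards [(isOpen_timeInterval c).mem_nhds ht] with τ hτ x y
    have h : ∀ x : k × p, diag LinearMap.id (qi τ) x =
        (diagEquiv k (solitonEquiv T hτ)).symm x := by
      intro x
      rw [diagEquiv_symm_apply, solitonEquiv_symm_apply]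
      rfl
    rw [solitonCurve_eq_act μ D hτ, act_equiv_apply, h, h]
    rfl
  · intro f f' hf
    refine (hρ.smul (hasDerivAt_linExp A hs (hasDerivAt_linExp T hs.neg hf))).congr_deriv ?_
    simp only [q, LinearMap.smul_apply, LinearMap.comp_apply, map_smul, hN]
    rw [← sub_skewPart, ← hA]
    simp only [map_add, map_sub, map_smul, apply_linExp_smul T]
    module
  · intro X
    refine ((hρ.inv hρ0).smul (hasDerivAt_linExp T hs
      (hasDerivAt_linExp A hs.neg (hasDerivAt_const t X)))).congr_deriv ?_
    have hX : X = linExp (sTime c t • A) (linExp ((-sTime c t) • A) X) := by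
      rw [neg_smul, linExp_apply_neg]
    have hN' : N X = -(-2 * c * t + 1)⁻¹ • linExp (sTime c t • A)
        (c • linExp ((-sTime c t) • A) X + (T (linExp ((-sTime c t) • A) X) -
          A (linExp ((-sTime c t) • A) X))) := by
      conv_lhs => rw [hX, hN, ← sub_skewPart, ← hA]
    have hGE : ∀ v, linExp ((-sTime c t) • A) (linExp (sTime c t • A) v) = v := by
      intro v
      rw [neg_smul, linExp_neg_apply]
    simp only [qi, LinearMap.smul_apply, LinearMap.comp_apply, hN', map_smul, hGE, Pi.inv_apply,
      ← apply_linExp_smul A, map_add, map_sub, add_zero]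
    match_scalars <;> field_simp

end

section

variable {k p : Type*} [NormedAddCommGroup k] [NormedSpace ℝ k]
  [NormedAddCommGroup p] [InnerProductSpace ℝ p] [FiniteDimensional ℝ p]

/-! ### Solitons evolve along the soliton curve -/

/-- The isotropy representation does not change along the soliton curve: `D_𝔭` commutes with it, and
so does the skew-symmetric part of `D_𝔭`. -/
theorem isHomogeneous_solitonCurve {μ : BracketSpace k p} (hμ : IsHomogeneous μ)
    {D : (k × p) →ₗ[ℝ] (k × p)} (hD : IsDerivationKilling μ D) {c t : ℝ}
    (ht : t ∈ timeInterval c) : IsHomogeneous (solitonCurve μ c D t) := by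
  rw [solitonCurve_eq_act μ D ht]
  refine hμ.act_diagEquiv _ fun Z X => ?_
  have h1 := hD.pPart_isotropy hμ
  have h2 := skewPart_isotropy hμ h1
  rw [solitonEquiv_apply, solitonEquiv_apply, map_smul,
    ← map_linExp_smul (isotropy μ Z) (pPart D) (pPart D) (fun X => (h1 Z X).symm),
    ← map_linExp_smul (isotropy μ Z) (skewPart (pPart D)) _ (fun X => (h2 Z X).symm)]

variable [FiniteDimensional ℝ k]

/-- The map `diag(I, q(t)) e^{s(t)D}` is an isomorphism from `μ` to the soliton curve, and it
induces `(-2ct+1)^{1/2} e^{s(t)A}` on `𝔤/𝔨`, a homothety. -/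
theorem ricciOperator_solitonCurve {μ : BracketSpace k p} (hμ : IsHomogeneous μ)
    {D : (k × p) →ₗ[ℝ] (k × p)} (hD : IsDerivationKilling μ D) {c t : ℝ}
    (ht : t ∈ timeInterval c) (X : p) :
    ricciOperator (solitonCurve μ c D t) (linExp (sTime c t • skewPart (pPart D)) X) =
      (-2 * c * t + 1)⁻¹ • linExp (sTime c t • skewPart (pPart D)) (ricciOperator μ X) := by
  have ht' : 0 < -2 * c * t + 1 := ht
  set A := skewPart (pPart D) with hA
  set ν := solitonCurve μ c D t with hν
  set ρ := √(-2 * c * t + 1) with hρ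
  have hρ0 : ρ ≠ 0 := (Real.sqrt_pos.2 ht').ne'
  have hρ2 : ρ * ρ = -2 * c * t + 1 := Real.mul_self_sqrt ht'.le
  let e : p ≃ₗ[ℝ] p := linExpEquiv (sTime c t • A) ≪≫ₗ LinearEquiv.smulOfNeZero ℝ p ρ hρ0
  have he : ∀ X, e X = ρ • linExp (sTime c t • A) X := fun _ => rfl
  have horth := inner_linExp_smul_skew A (skewPart_skew (pPart D)) (sTime c t)
  have hee : ∀ X Y, ⟪e X, e Y⟫ = (-2 * c * t + 1) * ⟪X, Y⟫ := by
    intro X Y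
    rw [he, he, real_inner_smul_left, real_inner_smul_right, horth, ← mul_assoc, hρ2]
  have hg : (innerₗ p).compl₁₂ e.toLinearMap e.toLinearMap = (-2 * c * t + 1) • innerₗ p := by
    ext X Y
    exact hee X Y
  let φ : (k × p) →ₗ[ℝ] (k × p) :=
    (diagEquiv k (solitonEquiv (pPart D) ht)).toLinearMap ∘ₗ linExp (sTime c t • D)
  have hric := ricciTensor_pullback hμ.alt (isHomogeneous_solitonCurve hμ hD ht) φ e
    (by
      intro x y
      simp only [φ, LinearMap.comp_apply, LinearEquiv.coe_coe]
      rw [linExp_smul_derivation μ D hD.leibniz, solitonCurve_eq_act μ D ht, act_equiv_apply,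
        LinearEquiv.symm_apply_apply, LinearEquiv.symm_apply_apply])
    (by
      intro x
      have h := map_linExp_smul (LinearMap.snd ℝ k p) D (pPart D) hD.pPart_apply (sTime c t) x
      simp only [LinearMap.snd_apply] at h
      simp only [φ, LinearMap.comp_apply, LinearEquiv.coe_coe]
      rw [diagEquiv_apply, solitonEquiv_apply, h, he, neg_smul, linExp_neg_apply])
  rw [hg, ricciTensor_smul_metric _ _ ht'.ne'] at hric
  have h : ricciOperator ν (e X) = (-2 * c * t + 1)⁻¹ • e (ricciOperator μ X) := by
    refine ext_inner_right ℝ fun Y => ?_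
    obtain ⟨Y, rfl⟩ := e.surjective Y
    rw [inner_ricciOperator, ← hric, real_inner_smul_left, hee, ← inner_ricciOperator,
      inv_mul_cancel_left₀ ht'.ne']
  rw [he, he, map_smul, smul_comm _ ρ] at h
  exact smul_right_injective p hρ0 h

theorem isBracketFlow_solitonCurve {μ : BracketSpace k p} (hμ : IsHomogeneous μ) {c : ℝ}
    {D : (k × p) →ₗ[ℝ] (k × p)} (hD : SolitonEquation μ c D) :
    IsBracketFlow μ (timeInterval c) (solitonCurve μ c D) where
  isOpen := isOpen_timeInterval c
  ordConnected := by
    refine Convex.ordConnected ?_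
    intro a ha b hb r s hr hs hrs
    have ha' : 0 < -2 * c * a + 1 := ha
    have hb' : 0 < -2 * c * b + 1 := hb
    have h : -2 * c * (r • a + s • b) + 1 = r * (-2 * c * a + 1) + s * (-2 * c * b + 1) := by
      simp only [smul_eq_mul]
      linear_combination (-1 : ℝ) * hrs
    change 0 < -2 * c * (r • a + s • b) + 1
    rw [h]
    rcases hr.eq_or_lt with rfl | hr
    · have : s = 1 := by linarith
      simpa [this] using hb'
    · positivity
  zero_mem := zero_mem_timeInterval c
  initial := by
    have h : ∀ x : k × p,
        (diagEquiv k (solitonEquiv (pPart D) (zero_mem_timeInterval c))).symm x = x := by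
      intro x
      rw [diagEquiv_symm_apply, solitonEquiv_symm_apply]
      simp [sTime_zero, linExp_zero]
    refine LinearMap.ext fun x => LinearMap.ext fun y => ?_
    rw [solitonCurve_eq_act μ D (zero_mem_timeInterval c), act_equiv_apply, h, h,
      ← LinearEquiv.eq_symm_apply, h]
  alt t ht x := (isHomogeneous_solitonCurve hμ hD.derivation ht).alt x
  hasDerivAt t ht x y := by
    rw [neg_rep_diag]
    refine hasDerivAt_solitonCurve μ D ht _ (fun X => ?_) x y
    rw [LinearMap.neg_apply, ricciOperator_solitonCurve hμ hD.derivation ht, neg_smul, hD.ricci_eq]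
    rfl

/-! ### The converse -/

/-- If a bracket flow solution follows the soliton curve of `D`, then comparing velocities at the
initial time shows that `diag(0, Ric - cI - ½(D_𝔭 + D_𝔭ᵗ))` is a derivation; it is added
to `D`. -/
theorem exists_solitonEquation {μ : BracketSpace k p} (hμ : IsHomogeneous μ) {c : ℝ}
    {D : (k × p) →ₗ[ℝ] (k × p)} (hD : IsDerivationKilling μ D) {J : Set ℝ}
    {ν : ℝ → BracketSpace k p} (hν : IsBracketFlow μ J ν)
    (h : ∀ t ∈ J ∩ timeInterval c, ν t = solitonCurve μ c D t) :
    ∃ D' : (k × p) →ₗ[ℝ] (k × p), SolitonEquation μ c D' ∧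
      skewPart (pPart D') = skewPart (pPart D) := by
  set S := symPart (pPart D) with hS
  have h0 := zero_mem_timeInterval c
  have hcurve0 : solitonCurve μ c D 0 = μ := by rw [← h 0 ⟨hν.zero_mem, h0⟩, hν.initial]
  have hev : ∀ᶠ t in nhds (0 : ℝ), t ∈ J ∩ timeInterval c :=
    (hν.isOpen.inter (isOpen_timeInterval c)).mem_nhds ⟨hν.zero_mem, h0⟩
  -- The two curves agree near `0`, so their velocities at `0` are equal.
  have hrep : ∀ x y, rep (diag 0 (-ricciOperator μ)) μ x y =
      rep (diag 0 (-(c • LinearMap.id + S))) μ x y := by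
    intro x y
    have h1 := hν.hasDerivAt 0 hν.zero_mem x y
    rw [neg_rep_diag, hν.initial] at h1
    have h2 := hasDerivAt_solitonCurve μ D h0 (-(c • LinearMap.id + S)) (fun X => by
      simp [sTime_zero, linExp_zero, hS, add_comm]) x y
    rw [hcurve0] at h2
    exact h1.unique (h2.congr_of_eventuallyEq (hev.mono fun t ht => by simp only [h t ht]))
  set R := ricciOperator μ - (c • LinearMap.id + S) with hR
  have hE : ∀ x y, diag (0 : k →ₗ[ℝ] k) R (μ x y) =
      μ (diag 0 R x) y + μ x (diag 0 R y) := by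
    intro x y
    have hsplit : ∀ v : k × p, diag 0 R v =
        diag 0 (-(c • LinearMap.id + S)) v - diag (0 : k →ₗ[ℝ] k) (-ricciOperator μ) v := by
      intro v
      ext <;> simp [hR]
      abel
    have h1 := hrep x y
    simp only [rep] at h1
    simp only [hsplit, map_sub, LinearMap.sub_apply]
    rw [← sub_eq_zero] at h1 ⊢
    rw [← neg_eq_zero, ← h1]
    abel
  have hSadj : LinearMap.adjoint S = S := by
    simp only [hS, symPart, map_smul, map_add, LinearMap.adjoint_adjoint, add_comm]
  have hRadj : LinearMap.adjoint R = R := by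
    simp only [hR, map_sub, map_add, map_smul, hSadj, adjoint_ricciOperator hμ,
      LinearMap.adjoint_id]
  have hp : pPart (D + diag 0 R) = pPart D + R := by
    ext X
    simp [pPart]
  refine ⟨D + diag 0 R, ⟨⟨fun x y => ?_, fun Z => ?_⟩, ?_⟩, ?_⟩
  · simp only [LinearMap.add_apply, map_add, hD.leibniz, hE]
    abel
  · simp [hD.apply_k]
  · rw [hp, symPart, map_add, hRadj]
    have : (1 / 2 : ℝ) • (pPart D + R + (LinearMap.adjoint (pPart D) + R)) = S + R := by
      rw [hS, symPart]; module
    rw [this, hR]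
    abel
  · rw [hp, skewPart, map_add, hRadj, skewPart, add_sub_add_right_eq_sub]

/-- The pullbacks of the metric under the automorphisms `e^{-s(t)D}`, scaled by `-2ct+1`, solve the
Ricci flow. -/
theorem SolitonEquation.isSemiAlgebraicSoliton {μ : BracketSpace k p} (hμ : IsHomogeneous μ)
    {c : ℝ} {D : (k × p) →ₗ[ℝ] (k × p)} (hD : SolitonEquation μ c D) :
    IsSemiAlgebraicSoliton μ := by
  obtain ⟨ε, hε, hball⟩ := Metric.isOpen_iff.1 (isOpen_timeInterval c) 0 (zero_mem_timeInterval c)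
  rw [Real.ball_eq_Ioo, zero_sub, zero_add] at hball
  set T := pPart D with hT
  have hsnd : ∀ (t : ℝ) (x : k × p), (linExp (t • D) x).2 = linExp (t • T) x.2 := fun t x =>
    map_linExp_smul (LinearMap.snd ℝ k p) D T hD.derivation.pPart_apply t x
  have hpb : ∀ t X Y, pullback (linExpEquiv ((-sTime c t) • D)) X Y =
      ⟪linExp ((-sTime c t) • T) X, linExp ((-sTime c t) • T) Y⟫ := by
    intro t X Y
    have h : ∀ X, pPart (linExpEquiv ((-sTime c t) • D)).toLinearMap X =
        linExp ((-sTime c t) • T) X := fun X => hsnd _ (0, X)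
    simp only [pullback, LinearMap.compl₁₂_apply, innerₗ_apply_apply, h]
  have haut : ∀ t x y, linExpEquiv ((-sTime c t) • D) (μ x y) =
      μ (linExpEquiv ((-sTime c t) • D) x) (linExpEquiv ((-sTime c t) • D) y) := fun t x y =>
    linExp_smul_derivation μ D hD.derivation.leibniz _ x y
  have hk : ∀ (t : ℝ) (Z : k), linExp (t • D) (Z, (0 : p)) = (Z, 0) := by
    intro t Z
    have h := eq_linExp_of_hasDerivAt D (f := fun _ => ((Z, 0) : k × p)) (fun t => by
      rw [hD.derivation.apply_k]
      exact hasDerivAt_const _ _) t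
    exact h.symm
  refine ⟨ε, hε, fun t => -2 * c * t + 1, fun t => linExpEquiv ((-sTime c t) • D),
    fun t ht => ⟨hball ht, haut t, ?_⟩, ?_, ?_⟩
  · rw [← LinearMap.range_comp]
    congr 1
    ext Z
    · exact congrArg Prod.fst (hk _ Z)
    · exact congrArg Prod.snd (hk _ Z)
  · ext X Y
    rw [LinearMap.smul_apply, LinearMap.smul_apply, hpb]
    simp [sTime_zero, linExp_zero]
  · intro t ht X Y
    have ht' : t ∈ timeInterval c := hball ht
    have ht0 : -2 * c * t + 1 ≠ 0 := (show 0 < -2 * c * t + 1 from ht').ne'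
    have h1 : HasDerivAt (fun t : ℝ => -2 * c * t + 1) (-2 * c) t := by
      simpa using ((hasDerivAt_id t).const_mul (-2 * c)).add_const 1
    have hs := (hasDerivAt_sTime ht').neg
    have hlin : ∀ X, HasDerivAt (fun τ => linExp ((-sTime c τ) • T) X)
        (-(-2 * c * t + 1)⁻¹ • T (linExp ((-sTime c t) • T) X)) t := by
      intro X
      refine (hasDerivAt_linExp T hs (hasDerivAt_const t X)).congr_deriv ?_
      rw [add_zero, map_smul, ← apply_linExp_smul]
      rfl
    have hd := h1.mul (hasDerivAt_bilinearMap_comp (innerₗ p) (hlin X) (hlin Y))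
    let e : p ≃ₗ[ℝ] p := linExpEquiv ((-sTime c t) • T)
    have hmetric : pullback (linExpEquiv ((-sTime c t) • D)) =
        (innerₗ p).compl₁₂ e.toLinearMap e.toLinearMap := by
      ext X Y
      exact hpb t X Y
    have hric := ricciTensor_pullback hμ.alt hμ (linExpEquiv ((-sTime c t) • D)).toLinearMap e
      (haut t) (hsnd _) X Y
    rw [ricciTensor_smul_metric _ _ ht0, hmetric, hric, ← inner_ricciOperator, hD.ricci_eq]
    refine (hd.congr_deriv ?_).congr_of_eventuallyEq (Filter.Eventually.of_forall fun τ => ?_)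
    · have he : ∀ X, e X = linExp ((-sTime c t) • T) X := fun _ => rfl
      simp only [he, symPart, LinearMap.add_apply, LinearMap.smul_apply, LinearMap.id_apply,
        innerₗ_apply_apply, inner_add_left, real_inner_smul_left, real_inner_smul_right,
        LinearMap.adjoint_inner_left, ← hT]
      clear_value e
      generalize -2 * c * t + 1 = r at ht0
      field_simp
      ring
    · simp only [LinearMap.smul_apply, smul_eq_mul, hpb, innerₗ_apply_apply, Pi.mul_apply]

end

section

/-! ### Uniqueness of the bracket flow -/

/-- Uniqueness of solutions of an autonomous equation with `C¹` right-hand side on an open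
interval. -/
theorem eqOn_of_hasDerivAt_contDiff {E : Type*} [NormedAddCommGroup E] [NormedSpace ℝ E]
    {F : E → E} (hF : ContDiff ℝ 1 F) {J : Set ℝ} (hJ : IsOpen J) (hJc : J.OrdConnected) {t₀ : ℝ}
    (ht₀ : t₀ ∈ J) {u v : ℝ → E} (hu : ∀ t ∈ J, HasDerivAt u (F (u t)) t)
    (hv : ∀ t ∈ J, HasDerivAt v (F (v t)) t) (h0 : u t₀ = v t₀) : Set.EqOn u v J := by
  intro t ht
  have hl : ∀ s ∈ J, (∃ a ∈ J, a < s) ∧ ∃ b ∈ J, s < b := by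
    intro s hs
    obtain ⟨l, r, hlr, hsub⟩ := mem_nhds_iff_exists_Ioo_subset.1 (hJ.mem_nhds hs)
    obtain ⟨a, ha⟩ := exists_between hlr.1
    obtain ⟨b, hb⟩ := exists_between hlr.2
    exact ⟨⟨a, hsub ⟨ha.1, ha.2.trans hlr.2⟩, ha.2⟩, b, hsub ⟨hlr.1.trans hb.1, hb.2⟩, hb.1⟩
  obtain ⟨a, haJ, ha⟩ : ∃ a ∈ J, a < t₀ ∧ a < t := by
    rcases le_total t₀ t with h | h
    · obtain ⟨a, haJ, ha⟩ := (hl t₀ ht₀).1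
      exact ⟨a, haJ, ha, ha.trans_le h⟩
    · obtain ⟨a, haJ, ha⟩ := (hl t ht).1
      exact ⟨a, haJ, ha.trans_le h, ha⟩
  obtain ⟨b, hbJ, hb⟩ : ∃ b ∈ J, t₀ < b ∧ t < b := by
    rcases le_total t₀ t with h | h
    · obtain ⟨b, hbJ, hb⟩ := (hl t ht).2
      exact ⟨b, hbJ, h.trans_lt hb, hb⟩
    · obtain ⟨b, hbJ, hb⟩ := (hl t₀ ht₀).2
      exact ⟨b, hbJ, hb, h.trans_lt hb⟩
  have hsub : Set.Icc a b ⊆ J := hJc.out haJ hbJ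
  have huc : ContinuousOn u (Set.Icc a b) := fun s hs =>
    (hu s (hsub hs)).continuousAt.continuousWithinAt
  have hvc : ContinuousOn v (Set.Icc a b) := fun s hs =>
    (hv s (hsub hs)).continuousAt.continuousWithinAt
  obtain ⟨K, hK⟩ := (hF.locallyLipschitz.locallyLipschitzOn).exists_lipschitzOnWith_of_compact
    ((isCompact_Icc.image_of_continuousOn huc).union (isCompact_Icc.image_of_continuousOn hvc))
  exact ODE_solution_unique_of_mem_Ioo (v := fun _ => F) (fun _ _ => hK) ⟨ha.1, hb.1⟩
    (fun s hs => have hs' := Set.Ioo_subset_Icc_self hs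
      ⟨hu s (hsub hs'), Or.inl (Set.mem_image_of_mem u hs')⟩)
    (fun s hs => have hs' := Set.Ioo_subset_Icc_self hs
      ⟨hv s (hsub hs'), Or.inr (Set.mem_image_of_mem v hs')⟩) h0 ⟨ha.2, hb.2⟩

theorem contDiff_apply_of_bilinear {E F G : Type*} [NormedAddCommGroup E] [NormedSpace ℝ E]
    [FiniteDimensional ℝ E] [NormedAddCommGroup F] [NormedSpace ℝ F] [FiniteDimensional ℝ F]
    [NormedAddCommGroup G] [NormedSpace ℝ G] (L : E →ₗ[ℝ] F →ₗ[ℝ] G) {f : E → F}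
    (hf : ContDiff ℝ 1 f) : ContDiff ℝ 1 fun v => L v (f v) :=
  L.toContinuousBilinearMap.contDiff.clm_apply hf

theorem contDiff_of_linear {E F : Type*} [NormedAddCommGroup E] [NormedSpace ℝ E]
    [FiniteDimensional ℝ E] [NormedAddCommGroup F] [NormedSpace ℝ F] (L : E →ₗ[ℝ] F) :
    ContDiff ℝ 1 fun v => L v :=
  (LinearMap.toContinuousLinearMap L).contDiff

variable {k p : Type*} [NormedAddCommGroup k] [NormedSpace ℝ k]
  [NormedAddCommGroup p] [InnerProductSpace ℝ p]

/-- The projection of bilinear maps onto alternating ones.  It serves to extend the vector field of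
the bracket flow smoothly to all bilinear maps: the Levi-Civita connection exists for alternating
ones only, and `leviCivita` has a default value elsewhere. -/
noncomputable def altPart : BracketSpace k p →ₗ[ℝ] BracketSpace k p where
  toFun μ := (1 / 2 : ℝ) • (μ - μ.flip)
  map_add' μ ν := by ext <;> simp <;> module
  map_smul' a μ := by ext <;> simp <;> module

theorem altPart_apply (μ : BracketSpace k p) (x y : k × p) :
    altPart μ x y = (1 / 2 : ℝ) • (μ x y - μ y x) := rfl

theorem altPart_self (μ : BracketSpace k p) (x : k × p) : altPart μ x x = 0 := by
  rw [altPart_apply, sub_self, smul_zero]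

theorem altPart_eq {μ : BracketSpace k p} (hμ : ∀ x, μ x x = 0) : altPart μ = μ := by
  refine LinearMap.ext fun x => LinearMap.ext fun y => ?_
  rw [altPart_apply, bracket_swap hμ y x]
  module

section Smoothness

variable {E : Type*} [NormedAddCommGroup E] [NormedSpace ℝ E] [FiniteDimensional ℝ E]
  (a : E →ₗ[ℝ] BracketSpace k p)

theorem contDiff_bracket_apply (x y : k × p) : ContDiff ℝ 1 fun v => a v x y :=
  contDiff_of_linear
    { toFun := fun v => a v x y
      map_add' := by intros; simp
      map_smul' := by intros; simp }

theorem contDiff_bracket_right [FiniteDimensional ℝ k] [FiniteDimensional ℝ p]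
    {f : E → k × p} (hf : ContDiff ℝ 1 f) (x : k × p) :
    ContDiff ℝ 1 fun v => a v x (f v) :=
  contDiff_apply_of_bilinear
    { toFun := fun v => a v x
      map_add' := by intros; simp
      map_smul' := by intros; simp } hf

theorem contDiff_bracket_left [FiniteDimensional ℝ k] [FiniteDimensional ℝ p]
    {f : E → k × p} (hf : ContDiff ℝ 1 f) (y : k × p) :
    ContDiff ℝ 1 fun v => a v (f v) y :=
  contDiff_apply_of_bilinear
    { toFun := fun v => (a v).flip y
      map_add' := by intros; ext <;> simp
      map_smul' := by intros; ext <;> simp } hf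

end Smoothness

variable [FiniteDimensional ℝ p]

/-- The Levi-Civita connection of the fixed inner product, as a linear function of the bracket.
Linearity follows from uniqueness. -/
noncomputable def altConn : BracketSpace k p →ₗ[ℝ] p →ₗ[ℝ] p →ₗ[ℝ] p where
  toFun μ := leviCivita (altPart μ) (innerₗ p)
  map_add' μ ν := by
    have h1 := isLeviCivita_standard (altPart_self μ)
    have h2 := isLeviCivita_standard (altPart_self ν)
    refine eq_leviCivita (altPart_self _) (fun X Y => real_inner_comm Y X) innerₗ_pos
      ⟨fun X Y => ?_, fun X Y Z => ?_⟩
    · rw [map_add]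
      change _ = pBracket (altPart μ) X Y + pBracket (altPart ν) X Y
      rw [← h1.torsion_free, ← h2.torsion_free]
      simp only [LinearMap.add_apply]
      abel
    · have a1 := h1.metric X Y Z
      have a2 := h2.metric X Y Z
      simp only [LinearMap.add_apply, map_add] at a1 a2 ⊢
      linarith
  map_smul' a μ := by
    have h1 := isLeviCivita_standard (altPart_self μ)
    refine eq_leviCivita (altPart_self _) (fun X Y => real_inner_comm Y X) innerₗ_pos
      ⟨fun X Y => ?_, fun X Y Z => ?_⟩
    · rw [map_smul]
      change _ = a • pBracket (altPart μ) X Y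
      rw [← h1.torsion_free]
      simp only [LinearMap.smul_apply, smul_sub, RingHom.id_apply]
    · have a1 := h1.metric X Y Z
      simp only [LinearMap.smul_apply, map_smul, RingHom.id_apply, smul_eq_mul] at a1 ⊢
      rw [← mul_add, a1, mul_zero]

theorem altConn_apply (μ : BracketSpace k p) :
    altConn μ = leviCivita (altPart μ) (innerₗ p) := rfl

section Smoothness

variable {E : Type*} [NormedAddCommGroup E] [NormedSpace ℝ E] [FiniteDimensional ℝ E]
  (a : E →ₗ[ℝ] BracketSpace k p)

theorem contDiff_altConn_right {f : E → p} (hf : ContDiff ℝ 1 f) (X : p) :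
    ContDiff ℝ 1 fun v => altConn (a v) X (f v) :=
  contDiff_apply_of_bilinear
    { toFun := fun v => altConn (a v) X
      map_add' := by intros; simp
      map_smul' := by intros; simp } hf

theorem contDiff_altConn_left {f : E → p} (hf : ContDiff ℝ 1 f) (Y : p) :
    ContDiff ℝ 1 fun v => altConn (a v) (f v) Y :=
  contDiff_apply_of_bilinear
    { toFun := fun v => (altConn (a v)).flip Y
      map_add' := by intros; ext; simp
      map_smul' := by intros; ext; simp } hf

variable [FiniteDimensional ℝ k]

theorem contDiff_ricciOperator_altPart (X : p) :
    ContDiff ℝ 1 fun v => ricciOperator (altPart (a v)) X := by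
  have hb : ∀ Z X, ContDiff ℝ 1 fun v => altPart (a v) (0, Z) (0, X) := fun Z X =>
    contDiff_bracket_apply (altPart ∘ₗ a) _ _
  have hΛ : ∀ X Y, ContDiff ℝ 1 fun v => altConn (a v) X Y := fun X Y =>
    contDiff_altConn_right a contDiff_const X
  have hcurv : ∀ Z X Y, ContDiff ℝ 1 fun v =>
      curvature (altPart (a v)) (altConn (a v)) Z X Y := fun Z X Y =>
    (((contDiff_altConn_right a (hΛ X Y) Z).sub (contDiff_altConn_right a (hΛ Z Y) X)).sub
      (contDiff_altConn_left a (hb Z X).snd Y)).sub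
      (contDiff_bracket_left (altPart ∘ₗ a) ((hb Z X).fst.prodMk contDiff_const) (0, Y)).snd
  have hric : ∀ X Y, ContDiff ℝ 1 fun v => ricciTensor (altPart (a v)) (innerₗ p) X Y := by
    intro X Y
    simp only [ricciTensor_eq_sum, ← altConn_apply]
    exact ContDiff.sum fun i _ => contDiff_const.inner ℝ (hcurv _ _ _)
  simp only [ricciOperator, LinearMap.sum_apply, LinearMap.smulRight_apply, LinearMap.flip_apply]
  exact ContDiff.sum fun i _ => (hric _ _).smul contDiff_const

theorem contDiff_bracketField (x y : k × p) :
    ContDiff ℝ 1 fun v => -rep (diag 0 (ricciOperator (altPart (a v)))) (a v) x y := by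
  have hdiag : ∀ f : E → k × p, ContDiff ℝ 1 f →
      ContDiff ℝ 1 fun v => diag (0 : k →ₗ[ℝ] k) (ricciOperator (altPart (a v))) (f v) := by
    intro f hf
    refine contDiff_const.prodMk (f := fun _ => (0 : k)) ?_
    have h : (fun v => ricciOperator (altPart (a v)) (f v).2) = fun v =>
        ∑ i, ⟪stdOrthonormalBasis ℝ p i, (f v).2⟫ •
          ricciOperator (altPart (a v)) (stdOrthonormalBasis ℝ p i) := by
      ext1 v
      conv_lhs => rw [← (stdOrthonormalBasis ℝ p).sum_repr' (f v).2]
      simp only [map_sum, map_smul]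
    change ContDiff ℝ 1 fun v => ricciOperator (altPart (a v)) (f v).2
    rw [h]
    exact ContDiff.sum fun i _ =>
      (contDiff_const.inner ℝ hf.snd).smul (contDiff_ricciOperator_altPart a _)
  exact (((hdiag _ (contDiff_bracket_apply a x y)).sub
    (contDiff_bracket_left a (hdiag _ contDiff_const) y)).sub
    (contDiff_bracket_right a (hdiag _ contDiff_const) x)).neg

end Smoothness

/-- The vector field of the bracket flow is polynomial in the structure constants, hence solutions
are unique. -/
theorem IsBracketFlow.eqOn [FiniteDimensional ℝ k] {μ : BracketSpace k p} {J J' : Set ℝ}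
    {ν ν' : ℝ → BracketSpace k p} (hν : IsBracketFlow μ J ν) (hν' : IsBracketFlow μ J' ν') :
    Set.EqOn ν ν' (J ∩ J') := by
  let b := Module.finBasis ℝ (k × p)
  let ι := Fin (Module.finrank ℝ (k × p))
  -- Brackets are identified with their structure constants on a basis of `𝔤`.
  let a : (ι → ι → k × p) →ₗ[ℝ] BracketSpace k p :=
    (b.constr ℝ).toLinearMap ∘ₗ (b.constr ℝ).toLinearMap.compLeft ι
  let coord : BracketSpace k p → ι → ι → k × p := fun μ i j => μ (b i) (b j)
  have hac : ∀ μ, a (coord μ) = μ := by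
    intro μ
    refine b.ext fun i => b.ext fun j => ?_
    simp [a, coord]
  let F : (ι → ι → k × p) → ι → ι → k × p := fun v i j =>
    -rep (diag 0 (ricciOperator (altPart (a v)))) (a v) (b i) (b j)
  have hF : ContDiff ℝ 1 F :=
    contDiff_pi.2 fun i => contDiff_pi.2 fun j => contDiff_bracketField a (b i) (b j)
  have hflow : ∀ {J : Set ℝ} {ν : ℝ → BracketSpace k p}, IsBracketFlow μ J ν → ∀ t ∈ J,
      HasDerivAt (fun τ => coord (ν τ)) (F (coord (ν t))) t := by
    intro J ν hν t ht
    refine hasDerivAt_pi.2 fun i => hasDerivAt_pi.2 fun j => ?_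
    have h := hν.hasDerivAt t ht (b i) (b j)
    simp only [F, hac, altPart_eq (hν.alt t ht)]
    exact h
  have heq := eqOn_of_hasDerivAt_contDiff hF (hν.isOpen.inter hν'.isOpen)
    (hν.ordConnected.inter hν'.ordConnected) ⟨hν.zero_mem, hν'.zero_mem⟩
    (fun t ht => hflow hν t ht.1) (fun t ht => hflow hν' t ht.2)
    (by simp only [hν.initial, hν'.initial])
  intro t ht
  rw [← hac (ν t), ← hac (ν' t)]
  exact congrArg a (heq ht)

end

section

/-! ### Symmetric derivations and the Heisenberg algebra -/

/-- The exponential of a block-diagonal symmetric derivation preserves the bracket, so such a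
derivation has the same soliton curve as `0`. -/
theorem solitonCurve_diag_symm {k p : Type*} [NormedAddCommGroup k] [NormedSpace ℝ k]
    [FiniteDimensional ℝ k] [NormedAddCommGroup p] [InnerProductSpace ℝ p] [FiniteDimensional ℝ p]
    (μ : BracketSpace k p) (c : ℝ) (T : p →ₗ[ℝ] p) (hT : LinearMap.adjoint T = T)
    (hD : ∀ x y, diag (0 : k →ₗ[ℝ] k) T (μ x y) = μ (diag 0 T x) y + μ x (diag 0 T y)) :
    solitonCurve μ c (diag 0 T) = solitonCurve μ c 0 := by
  have key : ∀ (T : p →ₗ[ℝ] p), LinearMap.adjoint T = T →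
      (∀ x y, diag (0 : k →ₗ[ℝ] k) T (μ x y) = μ (diag 0 T x) y + μ x (diag 0 T y)) →
      ∀ t, solitonCurve μ c (diag 0 T) t = rescale ((-2 * c * t + 1) ^ (-(1 / 2) : ℝ)) μ := by
    intro T hT hD t
    have hp : pPart (diag (0 : k →ₗ[ℝ] k) T) = T := rfl
    have hA : skewPart T = 0 := by rw [skewPart, hT, sub_self, smul_zero]
    let e := diagEquiv k (linExpEquiv ((-sTime c t) • T))
    have he : ∀ x, e x = linExp ((-sTime c t) • diag (0 : k →ₗ[ℝ] k) T) x := by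
      intro x
      have h1 := map_linExp_smul (LinearMap.fst ℝ k p) (diag 0 T) 0 (fun _ => rfl) (-sTime c t) x
      have h2 := map_linExp_smul (LinearMap.snd ℝ k p) (diag (0 : k →ₗ[ℝ] k) T) T (fun _ => rfl)
        (-sTime c t) x
      rw [smul_zero, linExp_zero] at h1
      exact Prod.ext h1.symm h2.symm
    have hexp : diag LinearMap.id (expEnd (sTime c t • skewPart T) ∘ₗ
        expEnd (-(sTime c t) • T)) = e.toLinearMap := by
      have h0 : expEnd (sTime c t • skewPart T) = LinearMap.id := by
        rw [hA, smul_zero]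
        exact linExp_zero
      rw [h0]
      rfl
    rw [solitonCurve, hp, hexp]
    congr 1
    refine LinearMap.ext fun x => LinearMap.ext fun y => ?_
    rw [act_equiv_apply, he, linExp_smul_derivation μ _ hD, ← he, ← he, e.apply_symm_apply,
      e.apply_symm_apply]
  have h0 : (0 : (k × p) →ₗ[ℝ] (k × p)) = diag 0 0 := by ext <;> simp
  ext1 t
  rw [h0, key T hT hD, key 0 (map_zero _) (by simp)]

/-- The Heisenberg algebra: `𝔨 = 0`, and `𝔭 = ℝ³` with `[e₀, e₁] = e₂`. -/
noncomputable def heisenberg : BracketSpace (EuclideanSpace ℝ (Fin 0)) (EuclideanSpace ℝ (Fin 3)) :=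
  LinearMap.mk₂ ℝ (fun x y => (0, !₂[0, 0, x.2 0 * y.2 1 - x.2 1 * y.2 0]))
    (by intros; ext i <;> fin_cases i <;> simp; ring)
    (by intros; ext i <;> fin_cases i <;> simp; ring)
    (by intros; ext i <;> fin_cases i <;> simp; ring)
    (by intros; ext i <;> fin_cases i <;> simp; ring)

theorem heisenberg_apply (x y : EuclideanSpace ℝ (Fin 0) × EuclideanSpace ℝ (Fin 3)) :
    heisenberg x y = (0, !₂[0, 0, x.2 0 * y.2 1 - x.2 1 * y.2 0]) := rfl

theorem isHomogeneous_heisenberg : IsHomogeneous heisenberg where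
  alt x := by
    ext i
    · exact i.elim0
    · fin_cases i <;> simp [heisenberg_apply]
      ring
  jacobi x y z := by
    ext i
    · exact i.elim0
    · fin_cases i <;> simp [heisenberg_apply]
  k_subalgebra Z W := by
    ext i
    fin_cases i <;> simp [heisenberg_apply]
  reductive Z X := rfl
  skew Z X Y := by
    have h : ∀ X, isotropy heisenberg Z X = 0 := by
      intro X
      ext i
      fin_cases i <;> simp [isotropy_apply, heisenberg_apply]
    rw [h, h, inner_zero_left, inner_zero_right, neg_zero]
  almost_effective Z _ := Subsingleton.elim _ _

/-- The Levi-Civita connection of the Heisenberg algebra. -/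
noncomputable def heisenbergConn : EuclideanSpace ℝ (Fin 3) →ₗ[ℝ] EuclideanSpace ℝ (Fin 3) →ₗ[ℝ]
    EuclideanSpace ℝ (Fin 3) :=
  LinearMap.mk₂ ℝ (fun X Y => !₂[(X 1 * Y 2 + X 2 * Y 1) / 2, -(X 0 * Y 2 + X 2 * Y 0) / 2,
      (X 0 * Y 1 - X 1 * Y 0) / 2])
    (by intros; ext i; fin_cases i <;> simp <;> ring)
    (by intros; ext i; fin_cases i <;> simp <;> ring)
    (by intros; ext i; fin_cases i <;> simp <;> ring)
    (by intros; ext i; fin_cases i <;> simp <;> ring)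

theorem heisenbergConn_apply (X Y : EuclideanSpace ℝ (Fin 3)) :
    heisenbergConn X Y = !₂[(X 1 * Y 2 + X 2 * Y 1) / 2, -(X 0 * Y 2 + X 2 * Y 0) / 2,
      (X 0 * Y 1 - X 1 * Y 0) / 2] := rfl

theorem leviCivita_heisenberg : leviCivita heisenberg (innerₗ _) = heisenbergConn := by
  refine eq_leviCivita isHomogeneous_heisenberg.alt (fun X Y => real_inner_comm Y X) innerₗ_pos
    ⟨fun X Y => ?_, fun X Y Z => ?_⟩
  · ext i
    fin_cases i <;> simp [heisenbergConn_apply, pBracket_apply, heisenberg_apply] <;> ring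
  · simp [heisenbergConn_apply, PiLp.inner_apply, Fin.sum_univ_three]
    ring

/-- The derivation `diag(1, 1, 2)` of the Heisenberg algebra. -/
noncomputable def heisenbergGrading : EuclideanSpace ℝ (Fin 3) →ₗ[ℝ] EuclideanSpace ℝ (Fin 3) where
  toFun X := !₂[X 0, X 1, 2 * X 2]
  map_add' X Y := by ext i; fin_cases i <;> simp; ring
  map_smul' a X := by ext i; fin_cases i <;> simp; ring

theorem heisenbergGrading_apply (X : EuclideanSpace ℝ (Fin 3)) :
    heisenbergGrading X = !₂[X 0, X 1, 2 * X 2] := rfl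

theorem adjoint_heisenbergGrading : LinearMap.adjoint heisenbergGrading = heisenbergGrading := by
  symm
  rw [LinearMap.eq_adjoint_iff]
  intro X Y
  simp [heisenbergGrading_apply, PiLp.inner_apply, Fin.sum_univ_three]
  ring

/-- The Heisenberg algebra is a nilsoliton: its Ricci operator is `diag(-½, -½, ½)`. -/
theorem solitonEquation_heisenberg :
    SolitonEquation heisenberg (-3 / 2) (diag 0 heisenbergGrading) where
  derivation :=
    { leibniz := by
        intro x y
        ext i
        · exact i.elim0
        · fin_cases i <;> simp [heisenberg_apply, heisenbergGrading_apply]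
          ring
      apply_k := by
        intro Z
        ext i <;> simp }
  ricci_eq := by
    have hp : pPart (diag (0 : EuclideanSpace ℝ (Fin 0) →ₗ[ℝ] _) heisenbergGrading) =
      heisenbergGrading := rfl
    have hs : symPart heisenbergGrading = heisenbergGrading := by
      rw [symPart, adjoint_heisenbergGrading]
      module
    rw [hp, hs]
    refine LinearMap.ext fun X => ext_inner_right ℝ fun Y => ?_
    rw [inner_ricciOperator, ricciTensor_apply, leviCivita_heisenberg,
      LinearMap.trace_eq_sum_inner _ (EuclideanSpace.basisFun (Fin 3) ℝ)]
    have hcurv : ∀ Z, ricciEnd heisenberg heisenbergConn X Y Z =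
        heisenbergConn Z (heisenbergConn X Y) - heisenbergConn X (heisenbergConn Z Y)
          - heisenbergConn (heisenberg (0, Z) (0, X)).2 Y := by
      intro Z
      have h0 : isotropy heisenberg (kBracket heisenberg Z X) Y = 0 := by
        rw [Subsingleton.elim (kBracket heisenberg Z X) 0, map_zero, LinearMap.zero_apply]
      change _ - _ - _ - isotropy heisenberg (kBracket heisenberg Z X) Y = _
      rw [h0, sub_zero]
      rfl
    simp [hcurv, heisenbergConn_apply, heisenberg_apply, heisenbergGrading_apply,
      PiLp.inner_apply, Fin.sum_univ_three]
    ring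

/-- For the Heisenberg algebra the derivation `0` has the same soliton curve as `diag(1, 1, 2)`: the
bracket flow only rescales the bracket.  But the metric is not Einstein, so `0` does not satisfy the
soliton equation. -/
theorem exists_isBracketFlow_forall_pPart_ne : ∃ (q n : ℕ)
    (μ₁ : BracketSpace (EuclideanSpace ℝ (Fin q)) (EuclideanSpace ℝ (Fin n))) (c₁ : ℝ)
    (D₁ : (EuclideanSpace ℝ (Fin q) × EuclideanSpace ℝ (Fin n)) →ₗ[ℝ]
      (EuclideanSpace ℝ (Fin q) × EuclideanSpace ℝ (Fin n))),
    IsHomogeneous μ₁ ∧ IsDerivationKilling μ₁ D₁ ∧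
    IsBracketFlow μ₁ (timeInterval c₁) (solitonCurve μ₁ c₁ D₁) ∧
    ∀ D', SolitonEquation μ₁ c₁ D' → skewPart (pPart D') = skewPart (pPart D₁) →
      pPart D' ≠ pPart D₁ := by
  have hsol := solitonEquation_heisenberg
  refine ⟨0, 3, heisenberg, -3 / 2, 0, isHomogeneous_heisenberg, ⟨by simp, by simp⟩, ?_, ?_⟩
  · rw [← solitonCurve_diag_symm heisenberg _ heisenbergGrading adjoint_heisenbergGrading
      hsol.derivation.leibniz]
    exact isBracketFlow_solitonCurve isHomogeneous_heisenberg hsol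
  · intro D' hD' _ hp
    have hp0 : pPart D' = 0 := by
      rw [hp]
      rfl
    have h := hD'.ricci_eq.symm.trans hsol.ricci_eq
    have hT : pPart (diag (0 : EuclideanSpace ℝ (Fin 0) →ₗ[ℝ] _) heisenbergGrading) =
      heisenbergGrading := rfl
    rw [hp0, hT, symPart, symPart, adjoint_heisenbergGrading, map_zero, add_zero] at h
    have h1 := congrArg (fun L => L (!₂[1, 0, 0] : EuclideanSpace ℝ (Fin 3)) 0) h
    simp [heisenbergGrading_apply] at h1

end

end BracketFlow

open BracketFlow in
theorem mainTheorem3 {k p : Type*} [NormedAddCommGroup k] [NormedSpace ℝ k]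
    [FiniteDimensional ℝ k] [NormedAddCommGroup p] [InnerProductSpace ℝ p]
    [FiniteDimensional ℝ p] (μ₀ : BracketSpace k p) (hμ₀ : IsHomogeneous μ₀) (c : ℝ)
    (D : (k × p) →ₗ[ℝ] (k × p)) :
    -- the evolution of a semi-algebraic soliton
    (SolitonEquation μ₀ c D →
      IsBracketFlow μ₀ (timeInterval c) (solitonCurve μ₀ c D) ∧
      ∀ (J : Set ℝ) (ν : ℝ → BracketSpace k p), IsBracketFlow μ₀ J ν →
        ∀ t ∈ J ∩ timeInterval c, ν t = solitonCurve μ₀ c D t) ∧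
    -- the converse
    (IsDerivationKilling μ₀ D →
      ∀ (J : Set ℝ) (ν : ℝ → BracketSpace k p), IsBracketFlow μ₀ J ν →
        (∀ t ∈ J ∩ timeInterval c, ν t = solitonCurve μ₀ c D t) →
        IsSemiAlgebraicSoliton μ₀ ∧
        ∃ D' : (k × p) →ₗ[ℝ] (k × p), SolitonEquation μ₀ c D' ∧
          skewPart (pPart D') = skewPart (pPart D)) ∧
    -- in the converse, the derivation may have to be changed
    (∃ (q n : ℕ)
      (μ₁ : BracketSpace (EuclideanSpace ℝ (Fin q)) (EuclideanSpace ℝ (Fin n))) (c₁ : ℝ)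
      (D₁ : (EuclideanSpace ℝ (Fin q) × EuclideanSpace ℝ (Fin n)) →ₗ[ℝ]
        (EuclideanSpace ℝ (Fin q) × EuclideanSpace ℝ (Fin n))),
      IsHomogeneous μ₁ ∧ IsDerivationKilling μ₁ D₁ ∧
      IsBracketFlow μ₁ (timeInterval c₁) (solitonCurve μ₁ c₁ D₁) ∧
      ∀ D', SolitonEquation μ₁ c₁ D' → skewPart (pPart D') = skewPart (pPart D₁) →
        pPart D' ≠ pPart D₁) := by
  refine ⟨fun hD => ?_, fun hD J ν hν h => ?_, exists_isBracketFlow_forall_pPart_ne⟩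
  · have hcurve := isBracketFlow_solitonCurve hμ₀ hD
    exact ⟨hcurve, fun J ν hν => hν.eqOn hcurve⟩
  · obtain ⟨D', hD', hskew⟩ := exists_solitonEquation hμ₀ hD hν h
    exact ⟨hD'.isSemiAlgebraicSoliton hμ₀, D', hD', hskew⟩
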